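/- Let $1\le q<\infty$, and let $\psi:[0,\infty)\to[0,\infty)$ be a nondecreasing concave function with $\psi(0)=0$ and $\psi(t)>0$ for $t>0$. Let $m$ be Lebesgue measure on $(0,\infty)$. For a measurable $x:(0,\infty)\to\mathbb R$ let $x^*(t)=\inf\{\tau\ge 0: m\{s>0:|x(s)|>\tau\}\le t\}$, $t\ge0$, be its nonincreasing rearrangement. The Lorentz space $\Lambda_q(\psi)$ consists of all (classes of) measurable $x$ with $$\|x\|_{\Lambda_q(\psi)}=\Big(\int_{[0,\infty)}x^*(t)^q\,d\psi(t)\Big)^{1/q}<\infty ,$$ where $d\psi$ is the Lebesgue--Stieltjes measure of $\psi$ (with an atom of mass $\psi(0+)$ at $0$ if $\psi(0+)>0$). For $p\in[1,\infty]$, write $p\in\mathcal F(\Lambda_q(\psi))$ if for every $n\in\mathbb N$ and $\varepsilon>0$ there are functions $x_1,\dots,x_n\in \Lambda_q(\psi)$ that are pairwise disjointly supported and equimeasurable (that is, $m\{|x_i|>\tau\}=m\{|x_j|>\tau\}$ for all $\tau>0$ and all $i,j$) such that $$(1+\varepsilon)^{-1}\|a\|_{p}\le\Big\|\sum_{k=1}^n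 a_kx_k\Big\|_{\Lambda_q(\psi)}\le(1+\varepsilon)\|a\|_{p}\qquad\text{for all } a=(a_k)_{k=1}^n\in\mathbb R^n ,$$ where $\|a\|_p$ is the $\ell^p$-norm. Put $$\alpha_{\psi,q}=-\lim_{n\to\infty}\frac1n\log_2\sup_{k\in\mathbb Z}\Big(\frac{\psi(2^k)}{\psi(2^{n+k})}\Big)^{1/q},\qquad \beta_{\psi,q}=\lim_{n\to\infty}\frac1n\log_2\sup_{k\in\mathbb Z}\Big(\frac{\psi(2^{n+k})}{\psi(2^{k})}\Big)^{1/q},$$ $$\alpha^\infty_{\psi,q}=-\lim_{n\to\infty}\frac1n\log_2\sup_{k\ge0}\Big(\frac{\psi(2^k)}{\psi(2^{k+n})}\Big)^{1/q},\qquad \beta^0_{\psi,q}=\lim_{n\to\infty}\frac1n\log_2\sup_{k\le0}\Big(\frac{\psi(2^{k})}{\psi(2^{k-n})}\Big)^{1/q}.$$ These limits exist and are nonnegative, and, with the convention $1/0=\infty$ and with intervals taken in $[0,\infty]$: (i) if $\alpha^\infty_{\psi,q}\le\beta^0_{\psi,q}$, then $\mathcal F(\Lambda_q(\psi))=[1/\beta_{\psi,q},\,1/\alpha_{\psi,q}]$;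 (ii) if $\alpha^\infty_{\psi,q}>\beta^0_{\psi,q}$, then $\mathcal F(\Lambda_q(\psi))=[1/\beta_{\psi,q},\,1/\alpha^\infty_{\psi,q}]\cup[1/\beta^0_{\psi,q},\,1/\alpha_{\psi,q}]$. -/

import Mathlib

open MeasureTheory Set Filter Topology
open scoped ENNReal

/-! ### Rearrangements and symmetric finite representability on `(0, ∞)` -/

/-- The distribution function `τ ↦ m {s > 0 : |x s| > τ}` of a function on `(0, ∞)`.
Functions on `(0, ∞)` are represented by functions `ℝ → ℝ`, whose values outside `(0, ∞)` are
never used. -/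
noncomputable def distribFun (x : ℝ → ℝ) (τ : ℝ≥0∞) : ℝ≥0∞ :=
  volume {s : ℝ | 0 < s ∧ τ < ENNReal.ofReal |x s|}

/-- The right-continuous nonincreasing rearrangement
`x* t = inf {τ ≥ 0 : m {s > 0 : |x s| > τ} ≤ t}`, with `inf ∅ = ∞`
(for `t = 0` this is the essential supremum of `|x|`). -/
noncomputable def rearrangement (x : ℝ → ℝ) (t : ℝ) : ℝ≥0∞ :=
  sInf {τ : ℝ≥0∞ | distribFun x τ ≤ ENNReal.ofReal t}

/-- `x` and `y` are equimeasurable on `(0, ∞)`. -/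
def Equimeasurable (x y : ℝ → ℝ) : Prop :=
  ∀ τ : ℝ, 0 < τ → volume {s : ℝ | 0 < s ∧ τ < |x s|} = volume {s : ℝ | 0 < s ∧ τ < |y s|}

/-- `x` and `y` have disjoint supports in `(0, ∞)`, up to a null set. -/
def DisjointSupports (x y : ℝ → ℝ) : Prop :=
  ∀ᵐ t ∂(volume.restrict (Ioi (0 : ℝ))), x t = 0 ∨ y t = 0

/-- The space of measurable functions on `(0, ∞)` on which the functional `N` is finite. -/
def functionSpace (N : (ℝ → ℝ) → ℝ≥0∞) : Set (ℝ → ℝ) :=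
  {x | AEMeasurable x (volume.restrict (Ioi (0 : ℝ))) ∧ N x < ∞}

/-- `ℓ^p` is symmetrically finitely represented in the function space with norm `N`. -/
def SymmFinitelyRepresented (N : (ℝ → ℝ) → ℝ≥0∞) (p : ℝ≥0∞) : Prop :=
  ∀ (n : ℕ) (ε : ℝ), 0 < ε → ∃ x : Fin n → ℝ → ℝ,
    (∀ k, x k ∈ functionSpace N) ∧
    (∀ i j, Equimeasurable (x i) (x j)) ∧
    (∀ i j, i ≠ j → DisjointSupports (x i) (x j)) ∧
    ∀ a : Fin n → ℝ,
      ENNReal.ofReal ((1 + ε)⁻¹ * ‖(WithLp.toLp p a : PiLp p fun _ : Fin n => ℝ)‖)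
          ≤ N (fun t => ∑ k, a k * x k t) ∧
        N (fun t => ∑ k, a k * x k t)
          ≤ ENNReal.ofReal ((1 + ε) * ‖(WithLp.toLp p a : PiLp p fun _ : Fin n => ℝ)‖)

/-- The set `F(X)` of all `p ∈ [1, ∞]` such that `ℓ^p` is symmetrically finitely represented
in the function space `X` with norm `N`. -/
def symmRepSet (N : (ℝ → ℝ) → ℝ≥0∞) : Set ℝ≥0∞ :=
  {p | 1 ≤ p ∧ SymmFinitelyRepresented N p}

/-! ### Lorentz spaces -/

theorem monotone_extend_of_monotoneOn {ψ : ℝ → ℝ} (hψ : MonotoneOn ψ (Ici 0)) :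
    Monotone fun t : ℝ => ψ (max t 0) := fun _ _ h =>
  hψ (mem_Ici.2 (le_max_right _ _)) (mem_Ici.2 (le_max_right _ _)) (max_le_max_right 0 h)

/-- The Lebesgue-Stieltjes measure `dψ` of a nondecreasing function `ψ` on `[0, ∞)`, as a measure
on `ℝ` concentrated on `[0, ∞)`. The function is extended by the constant `ψ 0` to the left, so
that the measure has the atom `ψ(0+) - ψ(0)` at `0`. -/
noncomputable def dPsi (ψ : ℝ → ℝ) (hψ : MonotoneOn ψ (Ici 0)) : Measure ℝ :=
  (monotone_extend_of_monotoneOn hψ).stieltjesFunction.measure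

/-- The norm `(∫_{[0, ∞)} (x* t)^q dψ(t))^{1/q}` of the Lorentz space `Λ_q(ψ)`. -/
noncomputable def lorentzNorm (q : ℝ) (ψ : ℝ → ℝ) (hψ : MonotoneOn ψ (Ici 0))
    (x : ℝ → ℝ) : ℝ≥0∞ :=
  (∫⁻ t in Ici (0 : ℝ), rearrangement x t ^ q ∂(dPsi ψ hψ)) ^ (1 / q)

/-! ### Dilation indices of `ψ ^ (1 / q)`

For each index, the sequence whose limit it is, and the limit itself. -/

noncomputable def alphaSeq (q : ℝ) (ψ : ℝ → ℝ) (n : ℕ) : ℝ :=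
  -(1 / (n : ℝ) *
    Real.logb 2 (⨆ k : ℤ, (ψ ((2 : ℝ) ^ k) / ψ ((2 : ℝ) ^ (n + k))) ^ (1 / q)))

noncomputable def betaSeq (q : ℝ) (ψ : ℝ → ℝ) (n : ℕ) : ℝ :=
  1 / (n : ℝ) *
    Real.logb 2 (⨆ k : ℤ, (ψ ((2 : ℝ) ^ (n + k)) / ψ ((2 : ℝ) ^ k)) ^ (1 / q))

noncomputable def alphaInfSeq (q : ℝ) (ψ : ℝ → ℝ) (n : ℕ) : ℝ :=
  -(1 / (n : ℝ) *
    Real.logb 2 (⨆ k : {k : ℤ // 0 ≤ k},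
      (ψ ((2 : ℝ) ^ (k : ℤ)) / ψ ((2 : ℝ) ^ ((k : ℤ) + n))) ^ (1 / q)))

noncomputable def betaZeroSeq (q : ℝ) (ψ : ℝ → ℝ) (n : ℕ) : ℝ :=
  1 / (n : ℝ) *
    Real.logb 2 (⨆ k : {k : ℤ // k ≤ 0},
      (ψ ((2 : ℝ) ^ (k : ℤ)) / ψ ((2 : ℝ) ^ ((k : ℤ) - n))) ^ (1 / q))

/-- `α_{ψ,q}` -/
noncomputable def alphaIdx (q : ℝ) (ψ : ℝ → ℝ) : ℝ := limUnder atTop (alphaSeq q ψ)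

/-- `β_{ψ,q}` -/
noncomputable def betaIdx (q : ℝ) (ψ : ℝ → ℝ) : ℝ := limUnder atTop (betaSeq q ψ)

/-- `α^∞_{ψ,q}` -/
noncomputable def alphaInfIdx (q : ℝ) (ψ : ℝ → ℝ) : ℝ := limUnder atTop (alphaInfSeq q ψ)

/-- `β^0_{ψ,q}` -/
noncomputable def betaZeroIdx (q : ℝ) (ψ : ℝ → ℝ) : ℝ := limUnder atTop (betaZeroSeq q ψ)

/-- `1 / a ∈ [0, ∞]` for an index `a ≥ 0`, with `1 / 0 = ∞`. -/
noncomputable def recipIdx (a : ℝ) : ℝ≥0∞ := (ENNReal.ofReal a)⁻¹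

/-! Write `g = 1/p`, `γ = q/p`. Everything follows from one criterion
(`symmFinitelyRepresented_lorentz_iff`): `p` is represented iff `α ≤ g ≤ β` and, in addition, `g ≤
β⁰` or `α^∞ ≤ g`. Cases (i) and (ii) only rewrite this in terms of `p`.

The bridge to `ψ` is a layer-cake formula (`lorentzNorm_rpow`): the `q`-th power of the norm is the
integral over `s > 0` of `ψ` at the measure of `{|x| > s^(1/q)}`. For disjoint functions these
measures add.

Necessity. Testing a representation on 0/1 vectors shows that the energy `E_j` of `2^j` disjoint
copies of one function is `2^(γ j)` up to the factors `2^(±q)`. Pointwise inequalities between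
values of `ψ` at `t`, `2^m t`, `2^(2m) t` integrate to inequalities between energies. Comparing two
energies gives `α ≤ g ≤ β`. If `β⁰ < g < α^∞`, then `ψ(2^m t)` is controlled from the left or from
the right according to its position relative to 1, and `E_m` is negligible against itself
(`not_represented_of_valley`).

Sufficiency, `p < ∞`. If `∑ |c_k|^p = 1`, disjoint copies of `c_k t^(-1/p)` have total distribution
`τ^(-p)`, whatever `c` is. Truncating the power to a dyadic range disturbs the energy only by
multiples of the end terms of `∑ 2^(-γ k) ψ(2^k)` over that range (`represented_of_intervals`), so
it suffices to find ranges whose end terms are small compared with the sum. If there are none, sums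
over centred windows grow geometrically, so the weights double within bounded distance of every
point, to the left or to the right. Doubling to the right propagates to the right, and
symmetrically, so the weights grow exponentially, decay exponentially, or form a valley
(`exp_growth_trichotomy`). These contradict `α ≤ g`, `g ≤ β` and the last condition respectively.

For `p = ∞`, `α = 0` makes `ψ` nearly constant on some `[L, nL]`, and indicators of intervals of
length `L` work. -/

/-! ### Growth exponents -/

/-- `L` is the optimal exponent `δ` in the bounds `x i n ≲ 2 ^ (q δ n) * y i n`, uniformly in
`i`. -/
def IsGrowthExponent {ι : Type*} (q : ℝ) (x y : ι → ℕ → ℝ) (L : ℝ) : Prop :=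
  (∀ δ, L < δ → ∀ᶠ n : ℕ in atTop, ∀ i, x i n ≤ (2 : ℝ) ^ (q * δ * n) * y i n) ∧
    ∀ δ C, 0 < C → (∀ᶠ n : ℕ in atTop, ∀ i, x i n ≤ C * (2 : ℝ) ^ (q * δ * n) * y i n) → L ≤ δ

theorem div_rpow_inv_le_iff {q x y c : ℝ} (hq : 0 < q) (hx : 0 < x) (hy : 0 < y) (hc : 0 < c) :
    (x / y) ^ (1 / q) ≤ c ↔ x ≤ c ^ q * y := by
  rw [one_div, Real.rpow_inv_le_iff_of_pos (by positivity) hc.le hq, div_le_iff₀ hy]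

/-- Fekete's lemma: `hsub` makes the logarithm of the supremum subadditive in `n`. The bounds by `2
^ n` keep the suprema finite and the normalised logarithms above `-1`. A constant `C` does not
affect the exponent, since `logb 2 (C ^ q⁻¹) / n` tends to 0. -/
theorem exists_growthExponent {ι : Type*} [Nonempty ι] {q : ℝ} (hq : 1 ≤ q) {x y : ι → ℕ → ℝ}
    (hx : ∀ i n, 0 < x i n) (hy : ∀ i n, 0 < y i n)
    (hxy : ∀ i n, x i n ≤ 2 ^ n * y i n) (hyx : ∀ i n, y i n ≤ 2 ^ n * x i n)
    (hsub : ∀ i m n, ∃ j, x i (m + n) / y i (m + n) ≤ (x i m / y i m) * (x j n / y j n)) :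
    ∃ L, Tendsto (fun n : ℕ => 1 / (n : ℝ) * Real.logb 2 (⨆ i, (x i n / y i n) ^ (1 / q)))
      atTop (𝓝 L) ∧ IsGrowthExponent q x y L := by
  have hq0 : 0 < q := by linarith
  set R : ι → ℕ → ℝ := fun i n => (x i n / y i n) ^ (1 / q) with hR
  have hRpos : ∀ i n, 0 < R i n := fun i n => Real.rpow_pos_of_pos (div_pos (hx i n) (hy i n)) _
  have hq1 : 1 / q ≤ 1 := by rw [div_le_one hq0]; exact hq
  have hpow : ∀ n : ℕ, (2 : ℝ) ^ n ≤ ((2 : ℝ) ^ n) ^ q := fun n => by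
    conv_lhs => rw [← Real.rpow_one ((2 : ℝ) ^ n)]
    exact Real.rpow_le_rpow_of_exponent_le (one_le_pow₀ one_le_two) hq
  have hRup : ∀ i n, R i n ≤ 2 ^ n := fun i n => by
    rw [hR, div_rpow_inv_le_iff hq0 (hx i n) (hy i n) (by positivity)]
    exact (hxy i n).trans (mul_le_mul_of_nonneg_right (hpow n) (hy i n).le)
  have hRlow : ∀ i n, ((2 : ℝ) ^ n)⁻¹ ≤ R i n := fun i n => by
    have h : (y i n / x i n) ^ (1 / q) ≤ 2 ^ n := by
      rw [div_rpow_inv_le_iff hq0 (hy i n) (hx i n) (by positivity)]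
      exact (hyx i n).trans (mul_le_mul_of_nonneg_right (hpow n) (hx i n).le)
    have h2 : R i n = ((y i n / x i n) ^ (1 / q))⁻¹ := by
      rw [← Real.inv_rpow (div_pos (hy i n) (hx i n)).le, inv_div]
    rw [h2]
    exact inv_anti₀ (Real.rpow_pos_of_pos (div_pos (hy i n) (hx i n)) _) h
  have hbdd : ∀ n, BddAbove (range fun i => R i n) := fun n => ⟨2 ^ n, by
    rintro _ ⟨i, rfl⟩; exact hRup i n⟩
  obtain ⟨i₀⟩ := ‹Nonempty ι›
  have : Nonempty ι := ⟨i₀⟩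
  have hSpos : ∀ n, 0 < ⨆ i, R i n := fun n => (hRpos i₀ n).trans_le (le_ciSup (hbdd n) i₀)
  have hsubadd : Subadditive fun n => Real.logb 2 (⨆ i, R i n) := by
    intro m n
    rw [← Real.logb_mul (hSpos m).ne' (hSpos n).ne']
    refine Real.logb_le_logb_of_le one_lt_two (hSpos _) (ciSup_le fun i => ?_)
    obtain ⟨j, hj⟩ := hsub i m n
    calc R i (m + n) ≤ ((x i m / y i m) * (x j n / y j n)) ^ (1 / q) :=
          Real.rpow_le_rpow (div_pos (hx _ _) (hy _ _)).le hj (by positivity)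
      _ = R i m * R j n :=
          Real.mul_rpow (div_pos (hx _ _) (hy _ _)).le (div_pos (hx _ _) (hy _ _)).le
      _ ≤ _ := mul_le_mul (le_ciSup (hbdd m) i) (le_ciSup (hbdd n) j) (hRpos _ _).le (hSpos m).le
  have hbb : BddBelow (range fun n : ℕ => Real.logb 2 (⨆ i, R i n) / n) := by
    refine ⟨-1, ?_⟩
    rintro _ ⟨n, rfl⟩
    rcases Nat.eq_zero_or_pos n with rfl | hn
    · simp
    · have hn' : (0 : ℝ) < n := by exact_mod_cast hn
      simp only
      rw [le_div_iff₀ hn', Real.le_logb_iff_rpow_le one_lt_two (hSpos n)]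
      refine le_trans (le_of_eq ?_) ((hRlow i₀ n).trans (le_ciSup (hbdd n) i₀))
      rw [neg_one_mul, Real.rpow_neg two_pos.le, Real.rpow_natCast]
  have hlim := hsubadd.tendsto_lim hbb
  have hcast : ∀ (δ : ℝ) (n : ℕ), ((2 : ℝ) ^ (δ * n)) ^ q = 2 ^ (q * δ * n) := fun δ n => by
    rw [← Real.rpow_mul two_pos.le]; ring_nf
  refine ⟨hsubadd.lim, ?_, ?_, ?_⟩
  · refine hlim.congr fun n => ?_
    rw [div_eq_inv_mul, one_div]
  · intro δ hδ
    filter_upwards [hlim.eventually (gt_mem_nhds hδ), eventually_gt_atTop 0] with n hn hn0 i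
    have hn' : (0 : ℝ) < n := by exact_mod_cast hn0
    rw [div_lt_iff₀ hn', Real.logb_lt_iff_lt_rpow one_lt_two (hSpos n)] at hn
    have := (le_ciSup (hbdd n) i).trans hn.le
    rwa [hR, div_rpow_inv_le_iff hq0 (hx i n) (hy i n) (by positivity), hcast] at this
  · intro δ C hC h
    have hlim2 : Tendsto (fun n : ℕ => Real.logb 2 (C ^ q⁻¹) / n + δ) atTop (𝓝 (0 + δ)) :=
      (tendsto_const_nhds.div_atTop tendsto_natCast_atTop_atTop).add tendsto_const_nhds
    rw [zero_add] at hlim2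
    refine le_of_tendsto_of_tendsto hlim hlim2 ?_
    filter_upwards [h, eventually_gt_atTop 0] with n hn hn0
    have hn' : (0 : ℝ) < n := by exact_mod_cast hn0
    have key : Real.logb 2 (⨆ i, R i n) ≤ Real.logb 2 (C ^ q⁻¹) + δ * n := by
      rw [Real.logb_le_iff_le_rpow one_lt_two (hSpos n), Real.rpow_add two_pos,
        Real.rpow_logb two_pos (by norm_num) (by positivity)]
      refine ciSup_le fun i => ?_
      rw [hR, div_rpow_inv_le_iff hq0 (hx i n) (hy i n) (by positivity),
        Real.mul_rpow (by positivity) (by positivity), hcast, Real.rpow_inv_rpow hC.le hq0.ne']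
      exact hn i
    calc Real.logb 2 (⨆ i, R i n) / n ≤ (Real.logb 2 (C ^ q⁻¹) + δ * n) / n := by gcongr
      _ = _ := by field_simp

/-! ### Sequences whose interval sums are controlled by their end terms -/

/-- If the sums of `v` over centred intervals are dominated by the end terms, then `v` doubles
within a bounded distance of every point. -/
theorem exists_doubling_of_sum_le {v : ℤ → ℝ} (hv : ∀ k, 0 < v k) (hlow : ∀ k, v k ≤ 2 * v (k - 1))
    {ε : ℝ} (hε : 0 < ε)
    (h : ∀ (k : ℤ) (j : ℕ), ε * ∑ i ∈ Finset.range (2 * j), v (k - j + i) ≤ v (k - j) + v (k + j)) :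
    ∃ N : ℕ, 0 < N ∧ ∀ k, 2 * v k ≤ v (k - N) ∨ 2 * v k ≤ v (k + N) := by
  -- The window is half-open, so enlarging it adds the right end term itself but, on the left, the
  -- term one place beyond the end term. By `hlow` that term is at least half of the end term, which
  -- is why `ε` becomes `ε / 2`.
  have hS : ∀ (k : ℤ) (j : ℕ), (1 + ε / 2) ^ j * v k ≤
      ∑ i ∈ Finset.range (2 * (j + 1)), v (k - (j + 1 : ℕ) + i) := by
    intro k j
    induction j with
    | zero =>
      have : k - 1 + 1 = k := by ring
      simp [Finset.sum_range_succ, this, (hv (k - 1)).le]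
    | succ j ih =>
      have h1 : ∑ i ∈ Finset.range (2 * (j + 1 + 1)), v (k - (j + 1 + 1 : ℕ) + i) =
          v (k - (j + 1 : ℕ) - 1) + ∑ i ∈ Finset.range (2 * (j + 1)), v (k - (j + 1 : ℕ) + i)
            + v (k + (j + 1 : ℕ)) := by
        rw [show 2 * (j + 1 + 1) = 2 * (j + 1) + 1 + 1 by ring, Finset.sum_range_succ,
          Finset.sum_range_succ', add_comm (v (k - (j + 1 : ℕ) - 1))]
        congr 1
        · congr 1
          · refine Finset.sum_congr rfl fun i _ => ?_
            congr 1; push_cast; ring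
          · congr 1; push_cast; ring
        · congr 1; push_cast; ring
      have h2 := h k (j + 1)
      have h3 := hlow (k - (j + 1 : ℕ))
      have h4 := hv (k + (j + 1 : ℕ))
      rw [h1, pow_succ]
      nlinarith
  -- If both end terms were below `2 * v k`, their sum would be below `4 * v k`, hence below `ε`
  -- times the window sum.
  obtain ⟨j, hj⟩ := pow_unbounded_of_one_lt (4 / ε) (show 1 < 1 + ε / 2 by linarith)
  refine ⟨j + 1, j.succ_pos, fun k => ?_⟩
  by_contra! hcon
  have h1 := hS k j
  have h2 := h k (j + 1)
  have h3 := hv k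
  rw [div_lt_iff₀ hε] at hj
  have h4 : ε * ((1 + ε / 2) ^ j * v k) ≤ v (k - (j + 1 : ℕ)) + v (k + (j + 1 : ℕ)) :=
    (mul_le_mul_of_nonneg_left h1 hε.le).trans h2
  nlinarith [hcon.1, hcon.2, mul_lt_mul_of_pos_right hj h3]

theorem le_two_pow_mul_of_le {v : ℤ → ℝ} (h : ∀ k, v (k + 1) ≤ 2 * v k) (k : ℤ) (n : ℕ) :
    v (k + n) ≤ 2 ^ n * v k := by
  induction n with
  | zero => simp
  | succ n ih =>
    have := h (k + n)
    rw [show k + ((n + 1 : ℕ) : ℤ) = k + n + 1 by push_cast; ring, pow_succ]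
    linarith

theorem two_pow_mul_le_of_step {v : ℤ → ℝ} {N : ℕ} {K : ℤ}
    (h : ∀ k, K ≤ k → 2 * v k ≤ v (k + N)) (j : ℕ) (k : ℤ) (hk : K ≤ k) :
    2 ^ j * v k ≤ v (k + (N * j : ℕ)) := by
  induction j with
  | zero => simp
  | succ j ih =>
    have := h (k + (N * j : ℕ)) (by omega)
    rw [show k + ((N * (j + 1) : ℕ) : ℤ) = k + (N * j : ℕ) + N by push_cast; ring, pow_succ]
    linarith

theorem le_two_pow_mul_add_of_le {v : ℤ → ℝ} (h : ∀ k, v k ≤ 2 * v (k + 1)) (k : ℤ) (n : ℕ) :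
    v k ≤ 2 ^ n * v (k + n) := by
  have := le_two_pow_mul_of_le (v := fun k => v (-k)) (fun k => by
    have := h (-(k + 1)); rwa [show -(k + 1) + 1 = -k by ring] at this) (-(k + n)) n
  simpa [show -(-(k + (n : ℤ)) + n) = k by ring] using this

/-- A point reached by doubling to the right cannot double back: `2 * v k ≤ v (k + N)` and `2 * v (k
+ N) ≤ v k` are incompatible. So the direction persists along the progression `k + N * j`. -/
theorem step_of_step {v : ℤ → ℝ} (hv : ∀ k, 0 < v k) {N : ℕ}
    (h : ∀ k, 2 * v k ≤ v (k - N) ∨ 2 * v k ≤ v (k + N)) {k : ℤ} (hk : 2 * v k ≤ v (k + N))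
    (j : ℕ) : 2 ^ j * v k ≤ v (k + (N * j : ℕ)) ∧
      2 * v (k + (N * j : ℕ)) ≤ v (k + (N * j : ℕ) + N) := by
  induction j with
  | zero => simpa using hk
  | succ j ih =>
    have he : k + ((N * (j + 1) : ℕ) : ℤ) = k + (N * j : ℕ) + N := by push_cast; ring
    rw [he]
    refine ⟨by rw [pow_succ]; linarith [ih.1, ih.2], ?_⟩
    rcases h (k + (N * j : ℕ) + N) with h1 | h1
    · rw [add_sub_cancel_right] at h1
      linarith [hv (k + (N * j : ℕ)), ih.2]
    · exact h1

/-- Persistence only concerns one residue class mod `N`. If a far point `l = k + N * j + i` doubled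
to the left, the chain going right from `k` and the chain going left from `l` would each gain `2 ^
j`, while closing the gap `i < N` costs only `2 ^ i`. The distance `N * N + N` forces `i < j`, a
contradiction. -/
theorem step_eventually_of_step {v : ℤ → ℝ} (hv : ∀ k, 0 < v k) (hup : ∀ k, v (k + 1) ≤ 2 * v k)
    (hlow : ∀ k, v k ≤ 2 * v (k + 1)) {N : ℕ} (hN : 0 < N)
    (h : ∀ k, 2 * v k ≤ v (k - N) ∨ 2 * v k ≤ v (k + N)) {k : ℤ} (hk : 2 * v k ≤ v (k + N))
    {l : ℤ} (hl : k + (N * N + N : ℕ) ≤ l) : 2 * v l ≤ v (l + N) := by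
  by_contra hcon
  have hdown := (h l).resolve_right hcon
  obtain ⟨n, rfl⟩ := Int.le.dest (show k ≤ l by have := Int.natCast_nonneg (N * N + N); linarith)
  have hn : N * N + N ≤ n := by
    have : ((N * N + N : ℕ) : ℤ) ≤ n := by linarith
    exact_mod_cast this
  obtain ⟨i, j, hi, hnij⟩ : ∃ i j, i < N ∧ n = N * j + i :=
    ⟨n % N, n / N, Nat.mod_lt _ hN, (Nat.div_add_mod n N).symm⟩
  have hij : i < j := by
    by_contra! hji
    have : N * j ≤ N * N := Nat.mul_le_mul_left N (by omega)
    omega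
  have h1 := (step_of_step hv h hk j).1
  have h2 := (step_of_step (v := fun k => v (-k)) (fun k => hv _) (N := N) (fun k => by
    rcases h (-k) with h' | h'
    · right; rwa [show -k - (N : ℤ) = -(k + N) by ring] at h'
    · left; rwa [show -k + (N : ℤ) = -(k - N) by ring] at h') (k := -(k + n))
      (by simpa [sub_eq_add_neg, add_comm, add_left_comm] using hdown) j).1
  simp only [neg_neg] at h2
  rw [show -(-(k + (n : ℤ)) + (N * j : ℕ)) = k + i by rw [hnij]; push_cast; ring] at h2
  have h3 := le_two_pow_mul_of_le hup k i
  have h4 := le_two_pow_mul_add_of_le hlow (k + (N * j : ℕ)) i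
  rw [show k + ((N * j : ℕ) : ℤ) + i = k + n by rw [hnij]; push_cast; ring] at h4
  have hpow : (2 : ℝ) ^ i < 2 ^ j := pow_lt_pow_right₀ one_lt_two hij
  have e1 : 2 ^ j * v (k + n) ≤ 2 ^ i * v k := h2.trans h3
  have e2 : 2 ^ j * v k ≤ 2 ^ i * v (k + n) := h1.trans h4
  have e3 := mul_lt_mul_of_pos_right hpow (hv k)
  have e4 := mul_lt_mul_of_pos_right hpow (hv (k + n))
  linarith

/-- Doubling every `N` steps is growth at rate `1 / N`. In the constant, `N` pays for the remainder
of `n` mod `N`, `1` for rounding `n / N`, and `2 * M` for shifting both endpoints by `M` into the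
region where doubling is known. -/
theorem exp_growth_of_step {v : ℤ → ℝ} (hv : ∀ k, 0 < v k) (hup : ∀ k, v (k + 1) ≤ 2 * v k)
    (hlow : ∀ k, v k ≤ 2 * v (k + 1)) {N : ℕ} (hN : 0 < N) {K : ℤ}
    (h : ∀ k, K ≤ k → 2 * v k ≤ v (k + N)) (M : ℕ) {k : ℤ} (hk : K ≤ k + M) (n : ℕ) :
    v k ≤ 2 ^ (N + 1 + 2 * M) * (2 : ℝ) ^ (-(1 / (N : ℝ) * n)) * v (k + n) := by
  have hN' : (0 : ℝ) < N := by exact_mod_cast hN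
  obtain ⟨i, j, hi, hnij⟩ : ∃ i j, i < N ∧ n = N * j + i :=
    ⟨n % N, n / N, Nat.mod_lt _ hN, (Nat.div_add_mod n N).symm⟩
  have h1 := two_pow_mul_le_of_step h j (k + M) hk
  have h2 := le_two_pow_mul_add_of_le hlow (k + M + (N * j : ℕ)) i
  have h3 := le_two_pow_mul_add_of_le hlow k M
  have h4 := le_two_pow_mul_of_le hup (k + n) M
  rw [show k + (M : ℤ) + ((N * j : ℕ) : ℤ) + i = k + n + M by rw [hnij]; push_cast; ring] at h2
  have h5 : (2 : ℝ) ^ i ≤ 2 ^ N := pow_le_pow_right₀ one_le_two hi.le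
  have h6 : (1 : ℝ) ≤ 2 * 2 ^ (-(1 / (N : ℝ) * n)) * 2 ^ j := by
    rw [← Real.rpow_natCast 2 j]
    nth_rw 1 [← Real.rpow_one 2]
    rw [← Real.rpow_add two_pos, ← Real.rpow_add two_pos]
    refine Real.one_le_rpow one_le_two ?_
    have : (n : ℝ) ≤ N * (j + 1) := by
      have : n ≤ N * (j + 1) := by rw [hnij, mul_add]; omega
      exact_mod_cast this
    have : 1 / (N : ℝ) * n ≤ j + 1 := by
      rw [one_div, inv_mul_le_iff₀ hN']; exact this
    linarith
  have hv1 := hv (k + M)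
  have hv2 := hv (k + n)
  set E : ℝ := (2 : ℝ) ^ (-(1 / (N : ℝ) * n)) with hE
  have hE0 : 0 < E := by positivity
  calc v k ≤ 2 ^ M * v (k + M) := h3
    _ ≤ 2 ^ M * ((2 * E * 2 ^ j) * v (k + M)) := by
        gcongr; exact le_mul_of_one_le_left hv1.le h6
    _ = 2 ^ M * (2 * E) * (2 ^ j * v (k + M)) := by ring
    _ ≤ 2 ^ M * (2 * E) * (2 ^ N * (2 ^ M * v (k + n))) := by
        refine mul_le_mul_of_nonneg_left (h1.trans (h2.trans ?_)) (by positivity)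
        have := hv (k + n + M)
        gcongr
    _ = _ := by ring

/-- A positive sequence with bounded ratios that doubles within a bounded distance of every point
grows exponentially, or decays exponentially, or decays up to some point and then grows. -/
theorem exp_growth_trichotomy {v : ℤ → ℝ} (hv : ∀ k, 0 < v k) (hup : ∀ k, v (k + 1) ≤ 2 * v k)
    (hlow : ∀ k, v k ≤ 2 * v (k + 1)) {N : ℕ} (hN : 0 < N)
    (h : ∀ k, 2 * v k ≤ v (k - N) ∨ 2 * v k ≤ v (k + N)) :
    ∃ δ : ℝ, 0 < δ ∧ ∃ C : ℝ, 0 < C ∧ ((∀ k, ∀ n : ℕ, v k ≤ C * (2 : ℝ) ^ (-(δ * n)) * v (k + n)) ∨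
      (∀ k, ∀ n : ℕ, v k ≤ C * (2 : ℝ) ^ (-(δ * n)) * v (k - n)) ∨
      ((∀ k, 0 ≤ k → ∀ n : ℕ, v k ≤ C * (2 : ℝ) ^ (-(δ * n)) * v (k + n)) ∧
        ∀ k, k ≤ 0 → ∀ n : ℕ, v k ≤ C * (2 : ℝ) ^ (-(δ * n)) * v (k - n))) := by
  have hN' : (0 : ℝ) < N := by exact_mod_cast hN
  have hu : ∀ k : ℤ, 0 < v (-k) := fun k => hv _
  have huup : ∀ k : ℤ, v (-(k + 1)) ≤ 2 * v (-k) := fun k => by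
    have := hlow (-(k + 1)); rwa [show -(k + 1) + 1 = -k by ring] at this
  have hulow : ∀ k : ℤ, v (-k) ≤ 2 * v (-(k + 1)) := fun k => by
    have := hup (-(k + 1)); rwa [show -(k + 1) + 1 = -k by ring] at this
  have huh : ∀ k : ℤ, 2 * v (-k) ≤ v (-(k - N)) ∨ 2 * v (-k) ≤ v (-(k + N)) := fun k => by
    rcases h (-k) with h' | h'
    · right; rwa [show -k - (N : ℤ) = -(k + N) by ring] at h'
    · left; rwa [show -k + (N : ℤ) = -(k - N) by ring] at h'
  have flip : ∀ {C E : ℝ} {k : ℤ} {n : ℕ}, v (-(-k)) ≤ C * E * v (-(-k + n)) →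
      v k ≤ C * E * v (k - n) := fun {C E k n} h' => by
    rwa [neg_neg, show -(-k + (n : ℤ)) = k - n by ring] at h'
  refine ⟨1 / N, by positivity, ?_⟩
  by_cases hall : ∀ k, 2 * v k ≤ v (k + N)
  · exact ⟨2 ^ (N + 1 + 2 * 0), by positivity, Or.inl fun k n =>
      exp_growth_of_step hv hup hlow hN (K := k) (k := k) (fun l _ => hall l) 0 (by simp) n⟩
  by_cases hall' : ∀ k, 2 * v k ≤ v (k - N)
  · refine ⟨2 ^ (N + 1 + 2 * 0), by positivity, Or.inr (Or.inl fun k n => flip ?_)⟩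
    exact exp_growth_of_step (v := fun k => v (-k)) hu huup hulow hN (K := -k) (k := -k) (fun l _ => by
      have := hall' (-l); rwa [show -l - (N : ℤ) = -(l + N) by ring] at this) 0 (by simp) n
  push Not at hall hall'
  obtain ⟨k₁, hk₁⟩ := hall'
  obtain ⟨k₂, hk₂⟩ := hall
  have h₁ := (h k₁).resolve_left hk₁.not_ge
  have h₂ := (h k₂).resolve_right hk₂.not_ge
  -- `k₁` doubles to the right and `k₂` to the left. Beyond distance `K` from the origin both
  -- directions have propagated; used again as the shift, `K` lets the two bounds start at 0.
  set K : ℕ := N * N + N + k₁.natAbs + k₂.natAbs with hK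
  refine ⟨2 ^ (N + 1 + 2 * K), by positivity, Or.inr (Or.inr ⟨fun k hk n => ?_, fun k hk n => ?_⟩)⟩
  · refine exp_growth_of_step hv hup hlow hN (K := K) (k := k) (fun l hl => ?_) K (by linarith) n
    refine step_eventually_of_step hv hup hlow hN h h₁ (le_trans ?_ hl)
    rw [hK]; push_cast; linarith [le_abs_self k₁, abs_nonneg k₂]
  · refine flip ?_
    refine exp_growth_of_step (v := fun k => v (-k)) hu huup hulow hN (K := K) (k := -k)
      (fun l hl => ?_) K
      (by linarith) n
    refine step_eventually_of_step (v := fun k => v (-k)) hu huup hulow hN huh (k := -k₂) ?_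
      (le_trans ?_ hl)
    · rwa [show -(-k₂ + (N : ℤ)) = k₂ - N by ring, neg_neg]
    · rw [hK]; push_cast; linarith [neg_abs_le k₂, abs_nonneg k₁]

/-- Either the weights `2 ^ (-γ k) * V k` have long intervals whose sum dominates the two end
terms, or `V` grows faster than `2 ^ (γ k)`, or slower, or slower on the left and faster on the
right. -/
theorem exists_interval_or_growth {V : ℤ → ℝ} (hV : ∀ k, 0 < V k) (hmono : ∀ k, V k ≤ V (k + 1))
    (hdbl : ∀ k, V (k + 1) ≤ 2 * V k) {γ : ℝ} (hγ0 : 0 ≤ γ) (hγ1 : γ ≤ 1) :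
    (∀ ε > 0, ∃ (a : ℤ) (n : ℕ), (2 : ℝ) ^ (-(γ * a)) * V a +
        (2 : ℝ) ^ (-(γ * (a + n : ℤ))) * V (a + n) ≤
      ε * ∑ i ∈ Finset.range n, (2 : ℝ) ^ (-(γ * (a + i : ℤ))) * V (a + i)) ∨
    ∃ δ : ℝ, 0 < δ ∧ ∃ C : ℝ, 0 < C ∧ ((∀ k, ∀ n : ℕ, V k ≤ C * (2 : ℝ) ^ (-((γ + δ) * n)) * V (k + n)) ∨
      (∀ k, ∀ n : ℕ, V k ≤ C * (2 : ℝ) ^ ((γ - δ) * n) * V (k - n)) ∨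
      ((∀ k, 0 ≤ k → ∀ n : ℕ, V k ≤ C * (2 : ℝ) ^ (-((γ + δ) * n)) * V (k + n)) ∧
        ∀ k, k ≤ 0 → ∀ n : ℕ, V k ≤ C * (2 : ℝ) ^ ((γ - δ) * n) * V (k - n))) := by
  set v : ℤ → ℝ := fun k => (2 : ℝ) ^ (-(γ * k)) * V k with hvdef
  have hv : ∀ k, 0 < v k := fun k => mul_pos (by positivity) (hV k)
  have hfac : ∀ k : ℤ, (2 : ℝ) ^ (-(γ * (k + 1 : ℤ))) = 2 ^ (-γ) * 2 ^ (-(γ * k)) := fun k => by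
    rw [← Real.rpow_add two_pos]; push_cast; ring_nf
  -- The restriction `0 ≤ γ ≤ 1` keeps the ratios of neighbouring weighted terms between `1/2` and
  -- `2`.
  have hγle : (2 : ℝ) ^ (-γ) ≤ 1 := Real.rpow_le_one_of_one_le_of_nonpos one_le_two (by linarith)
  have hγge : 1 ≤ 2 * (2 : ℝ) ^ (-γ) := by
    nth_rw 1 [← Real.rpow_one 2]
    rw [← Real.rpow_add two_pos]
    exact Real.one_le_rpow one_le_two (by linarith)
  have hup : ∀ k, v (k + 1) ≤ 2 * v k := fun k => by
    simp only [hvdef, hfac]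
    have h0 : (0 : ℝ) < 2 ^ (-(γ * k)) := by positivity
    have := hV (k + 1)
    calc (2 : ℝ) ^ (-γ) * 2 ^ (-(γ * k)) * V (k + 1) ≤ 1 * 2 ^ (-(γ * k)) * (2 * V k) := by
          gcongr; exact hdbl k
      _ = _ := by ring
  have hlow : ∀ k, v k ≤ 2 * v (k + 1) := fun k => by
    simp only [hvdef, hfac]
    have h0 : (0 : ℝ) < 2 ^ (-(γ * k)) := by positivity
    have := hV k
    calc (2 : ℝ) ^ (-(γ * k)) * V k ≤ (2 * 2 ^ (-γ)) * (2 ^ (-(γ * k)) * V k) :=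
          le_mul_of_one_le_left (by positivity) hγge
      _ ≤ (2 * 2 ^ (-γ)) * (2 ^ (-(γ * k)) * V (k + 1)) := by gcongr; exact hmono k
      _ = _ := by ring
  by_cases hgood : ∀ ε > 0, ∃ (a : ℤ) (n : ℕ),
      v a + v (a + n) ≤ ε * ∑ i ∈ Finset.range n, v (a + i)
  · exact Or.inl hgood
  right
  push Not at hgood
  obtain ⟨ε, hε, hbad⟩ := hgood
  obtain ⟨N, hN, hdoub⟩ := exists_doubling_of_sum_le hv (fun k => by simpa using hup (k - 1)) hε
    (fun k j => by
      have := (hbad (k - j) (2 * j)).le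
      rwa [show k - (j : ℤ) + ((2 * j : ℕ) : ℤ) = k + j by push_cast; ring] at this)
  obtain ⟨δ, hδ, C, hC, htri⟩ := exp_growth_trichotomy hv hup hlow hN hdoub
  have conv1 : ∀ {k : ℤ} {n : ℕ}, v k ≤ C * (2 : ℝ) ^ (-(δ * n)) * v (k + n) →
      V k ≤ C * (2 : ℝ) ^ (-((γ + δ) * n)) * V (k + n) := fun {k n} h' => by
    simp only [hvdef] at h'
    have h0 : (0 : ℝ) < 2 ^ (-(γ * k)) := by positivity
    refine le_of_mul_le_mul_left (h'.trans (le_of_eq ?_)) h0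
    rw [show -(γ * ((k + n : ℤ) : ℝ)) = -(γ * k) + -(γ * n) by push_cast; ring,
      show -((γ + δ) * (n : ℝ)) = -(γ * n) + -(δ * n) by ring, Real.rpow_add two_pos,
      Real.rpow_add two_pos]
    ring
  have conv2 : ∀ {k : ℤ} {n : ℕ}, v k ≤ C * (2 : ℝ) ^ (-(δ * n)) * v (k - n) →
      V k ≤ C * (2 : ℝ) ^ ((γ - δ) * n) * V (k - n) := fun {k n} h' => by
    simp only [hvdef] at h'
    have h0 : (0 : ℝ) < 2 ^ (-(γ * k)) := by positivity
    refine le_of_mul_le_mul_left (h'.trans (le_of_eq ?_)) h0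
    rw [show -(γ * ((k - n : ℤ) : ℝ)) = -(γ * k) + (γ * n) by push_cast; ring,
      show (γ - δ) * (n : ℝ) = (γ * n) + -(δ * n) by ring, Real.rpow_add two_pos,
      Real.rpow_add two_pos]
    ring
  refine ⟨δ, hδ, C, hC, ?_⟩
  rcases htri with h1 | h1 | ⟨h1, h2⟩
  · exact Or.inl fun k n => conv1 (h1 k n)
  · exact Or.inr (Or.inl fun k n => conv2 (h1 k n))
  · exact Or.inr (Or.inr ⟨fun k hk n => conv1 (h1 k hk n), fun k hk n => conv2 (h2 k hk n)⟩)

/-! ### The Lorentz norm in terms of the distribution function -/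

theorem distribFun_anti (x : ℝ → ℝ) : Antitone (distribFun x) := fun _ _ h =>
  measure_mono fun _ hs => ⟨hs.1, h.trans_lt hs.2⟩

theorem distribFun_eq_restrict (x : ℝ → ℝ) (τ : ℝ≥0∞) :
    distribFun x τ = volume.restrict (Ioi (0 : ℝ)) {s | τ < ENNReal.ofReal |x s|} := by
  rw [Measure.restrict_apply' measurableSet_Ioi, inter_comm]
  rfl

theorem distribFun_le_of_forall_gt {x : ℝ → ℝ} {τ b : ℝ≥0∞}
    (h : ∀ σ, τ < σ → distribFun x σ ≤ b) : distribFun x τ ≤ b := by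
  rcases eq_or_ne τ ∞ with rfl | hτ
  · simp [distribFun]
  obtain ⟨u, hu, hlt, hlim⟩ := exists_seq_strictAnti_tendsto' (lt_top_iff_ne_top.2 hτ)
  have hset : {s : ℝ | 0 < s ∧ τ < ENNReal.ofReal |x s|} =
      ⋃ n, {s : ℝ | 0 < s ∧ u n < ENNReal.ofReal |x s|} := by
    ext s
    simp only [mem_ofPred_eq, mem_iUnion]
    refine ⟨fun hs => ?_, fun ⟨n, hn⟩ => ⟨hn.1, (hlt n).1.trans hn.2⟩⟩
    obtain ⟨n, hn⟩ := (hlim.eventually (gt_mem_nhds hs.2)).exists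
    exact ⟨n, hs.1, hn⟩
  have hmono : Monotone fun n => {s : ℝ | 0 < s ∧ u n < ENNReal.ofReal |x s|} :=
    fun m n hmn s hs => ⟨hs.1, (hu.antitone hmn).trans_lt hs.2⟩
  rw [distribFun, hset, hmono.measure_iUnion]
  exact iSup_le fun n => h _ (hlt n).1

theorem rearrangement_anti (x : ℝ → ℝ) : Antitone (rearrangement x) := fun _ _ h =>
  sInf_le_sInf fun _ hτ => le_trans hτ (ENNReal.ofReal_le_ofReal h)

/-- The distribution function is right-continuous, so the infimum defining `x*` is attained and the
equivalence is exact. -/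
theorem lt_rearrangement_iff {x : ℝ → ℝ} {t : ℝ} {τ : ℝ≥0∞} :
    τ < rearrangement x t ↔ ENNReal.ofReal t < distribFun x τ := by
  rw [← not_le, ← not_le, not_iff_not]
  refine ⟨fun h => distribFun_le_of_forall_gt fun σ hσ => ?_, fun h => sInf_le h⟩
  obtain ⟨ρ, hρ, hρσ⟩ := sInf_lt_iff.1 (h.trans_lt hσ)
  exact (distribFun_anti x hρσ.le).trans hρ

theorem volume_Ioi_lt_eq (y : ℝ≥0∞) :
    volume {s : ℝ | 0 < s ∧ ENNReal.ofReal s < y} = y := by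
  rcases eq_or_ne y ∞ with rfl | hy
  · have : {s : ℝ | 0 < s ∧ ENNReal.ofReal s < ∞} = Ioi 0 := by ext; simp
    rw [this, Real.volume_Ioi]
  · have : {s : ℝ | 0 < s ∧ ENNReal.ofReal s < y} = Ioo 0 y.toReal := by
      ext s
      simp only [mem_ofPred_eq, mem_Ioo, and_congr_right_iff]
      exact fun hs => ENNReal.ofReal_lt_iff_lt_toReal hs.le hy
    rw [this, Real.volume_Ioo, sub_zero, ENNReal.ofReal_toReal hy]

theorem lintegral_eq_lintegral_measure_lt {α : Type*} [MeasurableSpace α] {μ : Measure α}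
    [SFinite μ] {f : α → ℝ≥0∞} (hf : Measurable f) :
    ∫⁻ t, f t ∂μ = ∫⁻ s in Ioi (0 : ℝ), μ {t | ENNReal.ofReal s < f t} := by
  have hS : MeasurableSet {p : α × ℝ | ENNReal.ofReal p.2 < f p.1} :=
    measurableSet_lt (ENNReal.measurable_ofReal.comp measurable_snd) (hf.comp measurable_fst)
  have h1 : ∀ t, f t = ∫⁻ s in Ioi (0 : ℝ),
      {p : α × ℝ | ENNReal.ofReal p.2 < f p.1}.indicator 1 (t, s) := fun t => by
    have hm : MeasurableSet {s : ℝ | ENNReal.ofReal s < f t} := measurable_prodMk_left hS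
    have : (fun s : ℝ => {p : α × ℝ | ENNReal.ofReal p.2 < f p.1}.indicator (1 : α × ℝ → ℝ≥0∞)
        (t, s)) = {s : ℝ | ENNReal.ofReal s < f t}.indicator 1 := rfl
    rw [this, lintegral_indicator_one hm, Measure.restrict_apply hm, inter_comm]
    exact (volume_Ioi_lt_eq (f t)).symm
  rw [lintegral_congr h1, lintegral_lintegral_swap]
  · refine lintegral_congr fun s => ?_
    have hm : MeasurableSet {t : α | ENNReal.ofReal s < f t} := measurable_prodMk_right hS
    exact lintegral_indicator_one hm
  · exact (measurable_one.indicator hS).aemeasurable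

/-- The extension `D ↦ dψ [0, D)` of `ψ` to `[0, ∞]`. -/
noncomputable def psiExt (ψ : ℝ → ℝ) (hψ : MonotoneOn ψ (Ici 0)) (D : ℝ≥0∞) : ℝ≥0∞ :=
  dPsi ψ hψ {t | 0 ≤ t ∧ ENNReal.ofReal t < D}

theorem psiExt_mono {ψ : ℝ → ℝ} (hψ : MonotoneOn ψ (Ici 0)) : Monotone (psiExt ψ hψ) :=
  fun _ _ h => measure_mono fun _ ht => ⟨ht.1, ht.2.trans_le h⟩

theorem psiExt_zero {ψ : ℝ → ℝ} (hψ : MonotoneOn ψ (Ici 0)) : psiExt ψ hψ 0 = 0 := by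
  simp [psiExt]

theorem psiExt_top_le {ψ : ℝ → ℝ} (hψ : MonotoneOn ψ (Ici 0)) {b : ℝ≥0∞}
    (h : ∀ t : ℝ, 0 < t → psiExt ψ hψ (ENNReal.ofReal t) ≤ b) : psiExt ψ hψ ∞ ≤ b := by
  have hset : {t : ℝ | 0 ≤ t ∧ ENNReal.ofReal t < ∞} =
      ⋃ n : ℕ, {t : ℝ | 0 ≤ t ∧ ENNReal.ofReal t < ENNReal.ofReal (n + 1)} := by
    ext t
    simp only [mem_ofPred_eq, ENNReal.ofReal_lt_top, and_true, mem_iUnion]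
    refine ⟨fun ht => ?_, fun ⟨n, hn⟩ => hn.1⟩
    obtain ⟨n, hn⟩ := exists_nat_gt t
    exact ⟨n, ht, (ENNReal.ofReal_lt_ofReal_iff (by positivity)).2 (by linarith)⟩
  have hmono : Monotone fun n : ℕ =>
      {t : ℝ | 0 ≤ t ∧ ENNReal.ofReal t < ENNReal.ofReal (n + 1)} := fun m n hmn t ht =>
    ⟨ht.1, ht.2.trans_le (ENNReal.ofReal_le_ofReal (by gcongr))⟩
  rw [psiExt, hset, hmono.measure_iUnion]
  exact iSup_le fun n => h _ (by positivity)

/-- The mass of `[0, t)` is a difference of left limits. Concavity gives continuity at `t > 0`, and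
the left limit at 0 is that of the constant extension by `ψ 0 = 0`, so a possible atom at 0 is
counted. -/
theorem psiExt_ofReal {ψ : ℝ → ℝ} (hψ : MonotoneOn ψ (Ici 0)) (hconc : ConcaveOn ℝ (Ici 0) ψ)
    (hzero : ψ 0 = 0) {t : ℝ} (ht : 0 ≤ t) :
    psiExt ψ hψ (ENNReal.ofReal t) = ENNReal.ofReal (ψ t) := by
  rcases ht.eq_or_lt with rfl | ht
  · simp [psiExt_zero, hzero]
  have hset : {s : ℝ | 0 ≤ s ∧ ENNReal.ofReal s < ENNReal.ofReal t} = Ico 0 t := by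
    ext s
    simp only [mem_ofPred_eq, mem_Ico, and_congr_right_iff]
    exact fun _ => ENNReal.ofReal_lt_ofReal_iff ht
  have hmon := monotone_extend_of_monotoneOn hψ
  have hleft : ∀ a, Function.leftLim hmon.stieltjesFunction a =
      Function.leftLim (fun t : ℝ => ψ (max t 0)) a := fun a => by
    have : (hmon.stieltjesFunction : ℝ → ℝ) = Function.rightLim fun t : ℝ => ψ (max t 0) :=
      funext fun x => hmon.stieltjesFunction_eq x
    rw [this, leftLim_rightLim]
    exact hmon.tendsto_leftLim a
  have h0 : Function.leftLim (fun t : ℝ => ψ (max t 0)) 0 = 0 := by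
    refine leftLim_eq_of_tendsto ?_
    refine tendsto_const_nhds.congr' ?_
    filter_upwards [self_mem_nhdsWithin] with s hs
    rw [max_eq_right (le_of_lt hs), hzero]
  have h1 : Function.leftLim (fun t : ℝ => ψ (max t 0)) t = ψ t := by
    have hc : ContinuousAt (fun t : ℝ => ψ (max t 0)) t := by
      have : ContinuousAt ψ t := by
        have := hconc.continuousOn_interior
        rw [interior_Ici] at this
        exact this.continuousAt (Ioi_mem_nhds ht)
      refine ContinuousAt.comp (f := fun t : ℝ => max t 0) (g := ψ) ?_ (by fun_prop)
      rwa [max_eq_left ht.le]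
    rw [hc.continuousWithinAt.leftLim_eq, max_eq_left ht.le]
  rw [psiExt, hset, dPsi, StieltjesFunction.measure_Ico, hleft, hleft, h0, h1, sub_zero]

/-- Layer cake with respect to `dψ`: the set where `x* ^ q` exceeds `s` is an initial segment, whose
length is the distribution function at `s^(1/q)`. -/
theorem lorentzNorm_rpow {q : ℝ} (hq : 0 < q) {ψ : ℝ → ℝ} (hψ : MonotoneOn ψ (Ici 0))
    (x : ℝ → ℝ) :
    lorentzNorm q ψ hψ x ^ q =
      ∫⁻ s in Ioi (0 : ℝ), psiExt ψ hψ (distribFun x (ENNReal.ofReal s ^ (1 / q))) := by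
  have : SFinite (dPsi ψ hψ) := by unfold dPsi; infer_instance
  rw [lorentzNorm, one_div, ENNReal.rpow_inv_rpow hq.ne',
    lintegral_eq_lintegral_measure_lt ((rearrangement_anti x).measurable.pow_const q)]
  refine lintegral_congr fun s => ?_
  rw [Measure.restrict_apply' measurableSet_Ici, psiExt, inter_comm]
  congr 1
  ext t
  simp only [mem_inter_iff, mem_Ici, mem_ofPred_eq, and_congr_right_iff]
  rw [← lt_rearrangement_iff, ENNReal.rpow_inv_lt_iff hq]
  exact fun _ => Iff.rfl

theorem measurable_psiExt_distribFun {q : ℝ} (hq : 0 < q) {ψ : ℝ → ℝ}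
    (hψ : MonotoneOn ψ (Ici 0)) (x : ℝ → ℝ) (c : ℝ≥0∞) :
    Measurable fun s : ℝ => psiExt ψ hψ (c * distribFun x (ENNReal.ofReal s ^ (1 / q))) := by
  refine Antitone.measurable fun s t hst => psiExt_mono hψ ?_
  gcongr
  exact distribFun_anti x (by gcongr)

theorem distribFun_sum {n : ℕ} {x : Fin n → ℝ → ℝ}
    (hx : ∀ k, AEMeasurable (x k) (volume.restrict (Ioi (0 : ℝ))))
    (hd : ∀ i j, i ≠ j → DisjointSupports (x i) (x j)) (a : Fin n → ℝ) (τ : ℝ≥0∞) :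
    distribFun (fun t => ∑ k, a k * x k t) τ = ∑ k, distribFun (fun t => a k * x k t) τ := by
  have hall : ∀ᵐ t ∂(volume.restrict (Ioi (0 : ℝ))), ∀ i j, i ≠ j → x i t = 0 ∨ x j t = 0 := by
    rw [ae_all_iff]; intro i
    rw [ae_all_iff]; intro j
    by_cases hij : i = j
    · simp [hij]
    · filter_upwards [hd i j hij] with t ht _ using ht
  simp only [distribFun_eq_restrict]
  have hset : {s : ℝ | τ < ENNReal.ofReal |∑ k, a k * x k s|} =ᵐ[volume.restrict (Ioi (0 : ℝ))]
      ⋃ k, {s : ℝ | τ < ENNReal.ofReal |a k * x k s|} := by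
    filter_upwards [hall] with s hs
    refine propext ?_
    change τ < _ ↔ s ∈ ⋃ k, _
    simp only [mem_iUnion, mem_ofPred_eq]
    by_cases hz : ∃ k, x k s ≠ 0
    · obtain ⟨k, hk⟩ := hz
      have hother : ∀ j, j ≠ k → a j * x j s = 0 := fun j hj => by
        rw [(hs j k hj).resolve_right hk, mul_zero]
      rw [Finset.sum_eq_single k (fun j _ hj => hother j hj) (by simp)]
      refine ⟨fun h => ⟨k, h⟩, fun ⟨j, hj⟩ => ?_⟩
      by_cases hjk : j = k
      · rwa [← hjk]
      · rw [hother j hjk] at hj; simp at hj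
    · push Not at hz
      simp [hz]
  rw [measure_congr hset, measure_iUnion₀, tsum_fintype]
  · intro i j hij
    refine measure_mono_null ?_ (hd i j hij)
    rintro s ⟨hi, hj⟩
    simp only [mem_compl_iff, mem_ofPred_eq, not_or]
    refine ⟨fun h0 => ?_, fun h0 => ?_⟩
    · simp [h0] at hi
    · simp [h0] at hj
  · intro k
    exact nullMeasurableSet_lt aemeasurable_const
      (ENNReal.measurable_ofReal.comp_aemeasurable (((hx k).const_mul (a k)).norm))

/-! ### Pointwise bounds for the weight -/

theorem mul_le_of_concaveOn_of_zero {ψ : ℝ → ℝ} (hconc : ConcaveOn ℝ (Ici 0) ψ) (hzero : ψ 0 = 0)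
    {c t : ℝ} (hc0 : 0 ≤ c) (hc1 : c ≤ 1) (ht : 0 ≤ t) : c * ψ t ≤ ψ (c * t) := by
  have := hconc.2 (mem_Ici.2 ht) (mem_Ici.2 le_rfl) hc0 (sub_nonneg.2 hc1) (by ring)
  simpa [hzero] using this

theorem le_mul_of_concaveOn_of_zero {ψ : ℝ → ℝ} (hconc : ConcaveOn ℝ (Ici 0) ψ) (hzero : ψ 0 = 0)
    {c t : ℝ} (hc : 1 ≤ c) (ht : 0 ≤ t) : ψ (c * t) ≤ c * ψ t := by
  have hc0 : 0 < c := by linarith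
  have := mul_le_of_concaveOn_of_zero hconc hzero (c := c⁻¹) (t := c * t) (by positivity)
    (inv_le_one_of_one_le₀ hc) (by positivity)
  rwa [inv_mul_cancel_left₀ hc0.ne', inv_mul_le_iff₀ hc0] at this

theorem add_le_of_concaveOn_of_zero {ψ : ℝ → ℝ} (hconc : ConcaveOn ℝ (Ici 0) ψ) (hzero : ψ 0 = 0)
    {s t : ℝ} (hs : 0 ≤ s) (ht : 0 ≤ t) : ψ (s + t) ≤ ψ s + ψ t := by
  rcases (add_nonneg hs ht).eq_or_lt with h | h
  · have h1 : s = 0 := by linarith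
    have h2 : t = 0 := by linarith
    simp [h1, h2, hzero]
  · have h1 := mul_le_of_concaveOn_of_zero hconc hzero (c := s / (s + t)) (t := s + t)
      (by positivity) (by rw [div_le_one h]; linarith) h.le
    have h2 := mul_le_of_concaveOn_of_zero hconc hzero (c := t / (s + t)) (t := s + t)
      (by positivity) (by rw [div_le_one h]; linarith) h.le
    rw [div_mul_cancel₀ _ h.ne'] at h1 h2
    have h3 : s / (s + t) * ψ (s + t) + t / (s + t) * ψ (s + t) = ψ (s + t) := by
      rw [← add_mul, ← add_div, div_self h.ne', one_mul]
    linarith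

theorem weight_zpow_succ_le {ψ : ℝ → ℝ} (hconc : ConcaveOn ℝ (Ici 0) ψ) (hzero : ψ 0 = 0) (k : ℤ) :
    ψ ((2 : ℝ) ^ (k + 1)) ≤ 2 * ψ ((2 : ℝ) ^ k) := by
  rw [zpow_add_one₀ two_ne_zero, mul_comm]
  exact le_mul_of_concaveOn_of_zero hconc hzero one_le_two (by positivity)

theorem weight_le_zpow_add {ψ : ℝ → ℝ} (hψ : MonotoneOn ψ (Ici 0)) {k l : ℤ} (h : k ≤ l) :
    ψ ((2 : ℝ) ^ k) ≤ ψ ((2 : ℝ) ^ l) :=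
  hψ (mem_Ici.2 (by positivity)) (mem_Ici.2 (by positivity)) (zpow_le_zpow_right₀ one_le_two h)

/-- Every point is within a factor two of a power of two. -/
theorem exists_weight_zpow {ψ : ℝ → ℝ} (hψ : MonotoneOn ψ (Ici 0)) (hconc : ConcaveOn ℝ (Ici 0) ψ)
    (hzero : ψ 0 = 0) {t : ℝ} (ht : 0 < t) : ∃ k : ℤ, ∀ n : ℤ,
      ψ ((2 : ℝ) ^ (k + n)) ≤ ψ (2 ^ n * t) ∧ ψ (2 ^ n * t) ≤ 2 * ψ ((2 : ℝ) ^ (k + n)) := by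
  obtain ⟨k, hk1, hk2⟩ := exists_mem_Ico_zpow ht one_lt_two
  refine ⟨k, fun n => ⟨?_, ?_⟩⟩
  · refine hψ (mem_Ici.2 (by positivity)) (mem_Ici.2 (by positivity)) ?_
    rw [zpow_add₀ two_ne_zero, mul_comm]
    gcongr
  · refine le_trans (hψ (mem_Ici.2 (by positivity)) (mem_Ici.2 (by positivity)) ?_)
      (weight_zpow_succ_le hconc hzero (k + n))
    rw [show k + n + 1 = n + (k + 1) by ring, zpow_add₀ two_ne_zero]
    gcongr

theorem two_pow_mul_ofReal (n : ℕ) (t : ℝ) :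
    (2 : ℝ≥0∞) ^ n * ENNReal.ofReal t = ENNReal.ofReal ((2 : ℝ) ^ (n : ℤ) * t) := by
  rw [ENNReal.ofReal_mul (by positivity), zpow_natCast, ENNReal.ofReal_pow zero_le_two,
    ENNReal.ofReal_ofNat]

/-- The factor 2 is the price of rounding `t` to a power of two; it is invisible to exponents. -/
theorem psiExt_two_pow_mul_le {ψ : ℝ → ℝ} (hψ : MonotoneOn ψ (Ici 0))
    (hconc : ConcaveOn ℝ (Ici 0) ψ) (hzero : ψ 0 = 0) {n : ℕ} {C : ℝ} (hC : 1 ≤ C)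
    (h : ∀ k : ℤ, ψ ((2 : ℝ) ^ (k + n)) ≤ C * ψ ((2 : ℝ) ^ k)) (D : ℝ≥0∞) :
    psiExt ψ hψ (2 ^ n * D) ≤ ENNReal.ofReal (2 * C) * psiExt ψ hψ D := by
  rcases eq_or_ne D 0 with rfl | hD0
  · simp [psiExt_zero]
  rcases eq_or_ne D ∞ with rfl | hD
  · rw [ENNReal.mul_top (by positivity)]
    exact le_mul_of_one_le_left zero_le (by
      rw [← ENNReal.ofReal_one]; exact ENNReal.ofReal_le_ofReal (by linarith))
  obtain ⟨t, ht, rfl⟩ : ∃ t : ℝ, 0 < t ∧ D = ENNReal.ofReal t :=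
    ⟨D.toReal, ENNReal.toReal_pos hD0 hD, (ENNReal.ofReal_toReal hD).symm⟩
  obtain ⟨k, hk⟩ := exists_weight_zpow hψ hconc hzero ht
  rw [two_pow_mul_ofReal, psiExt_ofReal hψ hconc hzero (by positivity),
    psiExt_ofReal hψ hconc hzero ht.le, ← ENNReal.ofReal_mul (by positivity)]
  refine ENNReal.ofReal_le_ofReal ?_
  have h0 := (hk 0).1
  simp only [add_zero, zpow_zero, one_mul] at h0
  calc ψ (2 ^ (n : ℤ) * t) ≤ 2 * ψ ((2 : ℝ) ^ (k + n)) := (hk n).2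
    _ ≤ 2 * (C * ψ t) := by
        refine mul_le_mul_of_nonneg_left ((h k).trans ?_) zero_le_two
        exact mul_le_mul_of_nonneg_left h0 (by linarith)
    _ = _ := by ring

theorem psiExt_le_two_pow_mul {ψ : ℝ → ℝ} (hψ : MonotoneOn ψ (Ici 0))
    (hconc : ConcaveOn ℝ (Ici 0) ψ) (hzero : ψ 0 = 0) {n : ℕ} {C : ℝ} (hC : 0 ≤ C)
    (h : ∀ k : ℤ, ψ ((2 : ℝ) ^ k) ≤ C * ψ ((2 : ℝ) ^ (k + n))) (D : ℝ≥0∞) :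
    psiExt ψ hψ D ≤ ENNReal.ofReal (2 * C) * psiExt ψ hψ (2 ^ n * D) := by
  have key : ∀ t : ℝ, 0 < t → psiExt ψ hψ (ENNReal.ofReal t) ≤
      ENNReal.ofReal (2 * C) * psiExt ψ hψ (2 ^ n * ENNReal.ofReal t) := fun t ht => by
    obtain ⟨k, hk⟩ := exists_weight_zpow hψ hconc hzero ht
    rw [two_pow_mul_ofReal, psiExt_ofReal hψ hconc hzero ht.le,
      psiExt_ofReal hψ hconc hzero (by positivity), ← ENNReal.ofReal_mul (by positivity)]
    refine ENNReal.ofReal_le_ofReal ?_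
    have h0 := (hk 0).2
    simp only [add_zero, zpow_zero, one_mul] at h0
    calc ψ t ≤ 2 * ψ ((2 : ℝ) ^ k) := h0
      _ ≤ 2 * (C * ψ (2 ^ (n : ℤ) * t)) := by
          refine mul_le_mul_of_nonneg_left ((h k).trans ?_) zero_le_two
          exact mul_le_mul_of_nonneg_left (hk n).1 hC
      _ = _ := by ring
  rcases eq_or_ne D 0 with rfl | hD0
  · simp [psiExt_zero]
  rcases eq_or_ne D ∞ with rfl | hD
  · rw [ENNReal.mul_top (by positivity)]
    -- The total mass of `dψ` may be finite, and `2 * C` may be less than 1, so `D = ∞` is not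
    -- trivial here; it is the limit of finite arguments.
    refine psiExt_top_le hψ fun t ht => (key t ht).trans ?_
    gcongr
    exact psiExt_mono hψ le_top
  · have := key D.toReal (ENNReal.toReal_pos hD0 hD)
    rwa [ENNReal.ofReal_toReal hD] at this

/-- The dyadic position of the middle point `2 ^ m * D` decides: left of 1 it is compared with the
point `m` steps down, right of 1 with the point `m` steps up. The sum covers both cases at once and
can therefore be integrated. -/
theorem psiExt_two_pow_mul_le_add {ψ : ℝ → ℝ} (hψ : MonotoneOn ψ (Ici 0))
    (hconc : ConcaveOn ℝ (Ici 0) ψ) (hzero : ψ 0 = 0) {m : ℕ} {C₁ C₂ : ℝ} (hC₁ : 1 ≤ C₁)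
    (hC₂ : 0 ≤ C₂) (hpos : ∀ t : ℝ, 0 < t → 0 < ψ t)
    (h₁ : ∀ k : ℤ, k ≤ 0 → ψ ((2 : ℝ) ^ k) ≤ C₁ * ψ ((2 : ℝ) ^ (k - m)))
    (h₂ : ∀ k : ℤ, 0 ≤ k → ψ ((2 : ℝ) ^ k) ≤ C₂ * ψ ((2 : ℝ) ^ (k + m))) (D : ℝ≥0∞) :
    psiExt ψ hψ (2 ^ m * D) ≤ ENNReal.ofReal (2 * C₁) * psiExt ψ hψ D +
      ENNReal.ofReal (2 * C₂) * psiExt ψ hψ (2 ^ (2 * m) * D) := by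
  rcases eq_or_ne D 0 with rfl | hD0
  · simp [psiExt_zero]
  rcases eq_or_ne D ∞ with rfl | hD
  · rw [ENNReal.mul_top (by positivity)]
    exact le_add_right (le_mul_of_one_le_left zero_le (by
      rw [← ENNReal.ofReal_one]; exact ENNReal.ofReal_le_ofReal (by linarith)))
  obtain ⟨t, ht, rfl⟩ : ∃ t : ℝ, 0 < t ∧ D = ENNReal.ofReal t :=
    ⟨D.toReal, ENNReal.toReal_pos hD0 hD, (ENNReal.ofReal_toReal hD).symm⟩
  obtain ⟨k, hk⟩ := exists_weight_zpow hψ hconc hzero ht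
  have hp := fun c : ℤ => (hpos (2 ^ c * t) (by positivity)).le
  rw [two_pow_mul_ofReal, two_pow_mul_ofReal, psiExt_ofReal hψ hconc hzero (by positivity),
    psiExt_ofReal hψ hconc hzero ht.le, psiExt_ofReal hψ hconc hzero (by positivity),
    ← ENNReal.ofReal_mul (by positivity), ← ENNReal.ofReal_mul (by positivity),
    ← ENNReal.ofReal_add (mul_nonneg (by positivity) (hpos t ht).le)
      (mul_nonneg (by positivity) (hp _))]
  refine ENNReal.ofReal_le_ofReal ?_
  have h0 := (hk 0).1
  simp only [add_zero, zpow_zero, one_mul] at h0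
  have hm := (hk m).2
  have h2m := (hk (2 * m : ℕ)).1
  have hp0 := (hpos t ht).le
  have hp2 := hp (2 * m : ℕ)
  rcases le_total (k + m) 0 with hkm | hkm
  · have := h₁ (k + m) hkm
    rw [add_sub_cancel_right] at this
    have h3 := mul_le_mul_of_nonneg_left h0 (show 0 ≤ C₁ by linarith)
    have h4 := mul_nonneg hC₂ hp2
    linarith
  · have := h₂ (k + m) hkm
    rw [show k + (m : ℤ) + m = k + (2 * m : ℕ) by push_cast; ring] at this
    have h3 := mul_le_mul_of_nonneg_left h2m hC₂
    have h4 := mul_nonneg (show 0 ≤ C₁ by linarith) hp0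
    linarith

/-! ### Necessity -/

/-- The `q`-th power of the Lorentz norm of the sum of `c` disjoint copies of `x`. -/
noncomputable def copiesEnergy (q : ℝ) (ψ : ℝ → ℝ) (hψ : MonotoneOn ψ (Ici 0)) (x : ℝ → ℝ)
    (c : ℝ≥0∞) : ℝ≥0∞ :=
  ∫⁻ s in Ioi (0 : ℝ), psiExt ψ hψ (c * distribFun x (ENNReal.ofReal s ^ (1 / q)))

theorem Equimeasurable.distribFun_eq {x y : ℝ → ℝ} (h : Equimeasurable x y) {τ : ℝ≥0∞}
    (h0 : τ ≠ 0) (htop : τ ≠ ∞) : distribFun x τ = distribFun y τ := by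
  have key : ∀ z : ℝ → ℝ, distribFun z τ = volume {s : ℝ | 0 < s ∧ τ.toReal < |z s|} := fun z => by
    simp only [distribFun, ENNReal.lt_ofReal_iff_toReal_lt htop]
  rw [key, key, h _ (ENNReal.toReal_pos h0 htop)]

theorem sum_fin_ite_lt {M : Type*} [AddCommMonoid M] {m n : ℕ} (h : m ≤ n) (c : M) :
    (∑ k : Fin n, if (k : ℕ) < m then c else 0) = m • c := by
  rw [Fin.sum_univ_eq_sum_range (fun k => if k < m then c else 0) n, ← Finset.sum_filter]
  have : (Finset.range n).filter (· < m) = Finset.range m := by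
    ext k; simp only [Finset.mem_filter, Finset.mem_range]; omega
  rw [this, Finset.sum_const, Finset.card_range]

theorem norm_toLp_ite_lt {p : ℝ≥0∞} (hp : 1 ≤ p) {m n : ℕ} (hm : 0 < m) (h : m ≤ n) :
    ‖(WithLp.toLp p (fun k : Fin n => if (k : ℕ) < m then (1 : ℝ) else 0) :
      PiLp p fun _ : Fin n => ℝ)‖ = (m : ℝ) ^ (p⁻¹).toReal := by
  rcases eq_or_ne p ∞ with rfl | hp'
  · have : Nonempty (Fin n) := ⟨⟨0, by omega⟩⟩
    rw [PiLp.norm_eq_ciSup]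
    simp only [ENNReal.inv_top, ENNReal.toReal_zero, Real.rpow_zero]
    refine le_antisymm (ciSup_le fun k => ?_) ?_
    · split_ifs <;> simp
    · refine le_ciSup_of_le (finite_range _).bddAbove ⟨0, by omega⟩ ?_
      simp [hm]
  · have hp0 : 0 < p.toReal := ENNReal.toReal_pos (by positivity) hp'
    rw [PiLp.norm_eq_sum hp0, ENNReal.toReal_inv, one_div]
    congr 1
    have : ∀ k : Fin n, ‖(if (k : ℕ) < m then (1 : ℝ) else 0)‖ ^ p.toReal =
        if (k : ℕ) < m then 1 else 0 := fun k => by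
      split_ifs
      · simp
      · simp [hp0.ne']
    simp only [this]
    rw [sum_fin_ite_lt h, nsmul_eq_mul, mul_one]

/-- The representation with `ε = 1` is tested on vectors with `2 ^ j` ones, of norm `2 ^ (j / p)`.
The same `x` serves all `j ≤ J`, so that energies for different `j` can be compared. -/
theorem exists_copiesEnergy_bounds {q : ℝ} (hq : 1 ≤ q) {ψ : ℝ → ℝ} (hψ : MonotoneOn ψ (Ici 0))
    {p : ℝ≥0∞} (hp : 1 ≤ p) (hrep : SymmFinitelyRepresented (lorentzNorm q ψ hψ) p) (J : ℕ) :
    ∃ x, ∀ j ≤ J,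
      ENNReal.ofReal ((2 : ℝ) ^ (-q) * (2 : ℝ) ^ (q * (p⁻¹).toReal * j)) ≤
          copiesEnergy q ψ hψ x (2 ^ j) ∧
        copiesEnergy q ψ hψ x (2 ^ j) ≤
          ENNReal.ofReal ((2 : ℝ) ^ q * (2 : ℝ) ^ (q * (p⁻¹).toReal * j)) := by
  have hq0 : 0 < q := by linarith
  obtain ⟨x, hx, heq, hdisj, hnorm⟩ := hrep (2 ^ J) 1 one_pos
  set i₀ : Fin (2 ^ J) := ⟨0, by positivity⟩
  refine ⟨x i₀, fun j hj => ?_⟩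
  have hle : 2 ^ j ≤ 2 ^ J := Nat.pow_le_pow_right two_pos hj
  set a : Fin (2 ^ J) → ℝ := fun k => if (k : ℕ) < 2 ^ j then (1 : ℝ) else 0 with ha
  -- `Equimeasurable` speaks only of finite positive levels; those are the only ones met for `s >
  -- 0`.
  have hdist : ∀ τ : ℝ≥0∞, τ ≠ 0 → τ ≠ ∞ →
      distribFun (fun t => ∑ k, a k * x k t) τ = 2 ^ j * distribFun (x i₀) τ := fun τ h0 htop => by
    rw [distribFun_sum (fun k => (hx k).1) hdisj]
    have : ∀ k, distribFun (fun t => a k * x k t) τ =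
        if (k : ℕ) < 2 ^ j then distribFun (x i₀) τ else 0 := fun k => by
      simp only [ha]
      split_ifs with hk
      · simp only [one_mul]
        exact (heq k i₀).distribFun_eq h0 htop
      · simp [distribFun]
    simp only [this]
    rw [sum_fin_ite_lt hle, nsmul_eq_mul]
    push_cast; rfl
  have hE : lorentzNorm q ψ hψ (fun t => ∑ k, a k * x k t) ^ q =
      copiesEnergy q ψ hψ (x i₀) (2 ^ j) := by
    rw [lorentzNorm_rpow hq0, copiesEnergy]
    refine setLIntegral_congr_fun measurableSet_Ioi fun s hs => ?_
    have hs' : ENNReal.ofReal s ≠ 0 := (ENNReal.ofReal_pos.2 hs).ne'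
    rw [hdist _ (by simp [hs', hq0.not_gt, ENNReal.rpow_eq_zero_iff])
      (by simp [hq0.not_gt, hs', ENNReal.rpow_eq_top_iff])]
  have hn := hnorm a
  rw [norm_toLp_ite_lt hp (by positivity) hle] at hn
  have hpow : (((2 ^ j : ℕ) : ℝ) ^ (p⁻¹).toReal) ^ q = (2 : ℝ) ^ (q * (p⁻¹).toReal * j) := by
    push_cast
    rw [← Real.rpow_natCast, ← Real.rpow_mul zero_le_two, ← Real.rpow_mul zero_le_two]
    ring_nf
  have hinv : (((1 : ℝ) + 1)⁻¹) ^ q = 2 ^ (-q) := by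
    rw [one_add_one_eq_two, Real.inv_rpow zero_le_two, Real.rpow_neg zero_le_two]
  rw [← hE]
  constructor
  · refine le_trans (le_of_eq ?_) (ENNReal.rpow_le_rpow hn.1 hq0.le)
    rw [ENNReal.ofReal_rpow_of_nonneg (by positivity) hq0.le,
      Real.mul_rpow (by positivity) (by positivity), hpow, hinv]
  · refine (ENNReal.rpow_le_rpow hn.2 hq0.le).trans (le_of_eq ?_)
    rw [ENNReal.ofReal_rpow_of_nonneg (by positivity) hq0.le,
      Real.mul_rpow (by positivity) (by positivity), hpow, one_add_one_eq_two]

theorem le_of_eventually_two_rpow_le {q g δ K : ℝ} (hq : 0 < q)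
    (h : ∀ᶠ n : ℕ in atTop, (2 : ℝ) ^ (q * g * n) ≤ K * (2 : ℝ) ^ (q * δ * n)) : g ≤ δ := by
  by_contra! hlt
  have h1 : (1 : ℝ) < 2 ^ (q * (g - δ)) :=
    Real.one_lt_rpow one_lt_two (mul_pos hq (sub_pos.2 hlt))
  obtain ⟨n, hn1, hn2⟩ := (((tendsto_pow_atTop_atTop_of_one_lt h1).eventually_gt_atTop K).and
    h).exists
  rw [← Real.rpow_mul_natCast zero_le_two] at hn1
  have h2 : (0 : ℝ) < 2 ^ (q * δ * n) := by positivity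
  have h3 := mul_lt_mul_of_pos_right hn1 h2
  rw [← Real.rpow_add two_pos, show q * (g - δ) * n + q * δ * n = q * g * n by ring] at h3
  linarith

theorem recip_le_of_represented {q : ℝ} (hq : 1 ≤ q) {ψ : ℝ → ℝ} (hψ : MonotoneOn ψ (Ici 0))
    (hconc : ConcaveOn ℝ (Ici 0) ψ) (hzero : ψ 0 = 0) {p : ℝ≥0∞} (hp : 1 ≤ p)
    (hrep : SymmFinitelyRepresented (lorentzNorm q ψ hψ) p) {b : ℝ} (hb : 0 ≤ b)
    (hgrow : IsGrowthExponent q (fun (k : ℤ) (n : ℕ) => ψ ((2 : ℝ) ^ (k + n)))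
      (fun k _ => ψ ((2 : ℝ) ^ k)) b) : (p⁻¹).toReal ≤ b := by
  have hq0 : 0 < q := by linarith
  refine le_of_forall_gt_imp_ge_of_dense fun δ hδ => ?_
  refine le_of_eventually_two_rpow_le (q := q) (K := 2 ^ q * (2 * 2 ^ q)) hq0 ?_
  filter_upwards [hgrow.1 δ hδ] with n hn
  obtain ⟨x, hx⟩ := exists_copiesEnergy_bounds hq hψ hp hrep n
  have hC : (1 : ℝ) ≤ 2 ^ (q * δ * n) :=
    Real.one_le_rpow one_le_two (by have := hb.trans hδ.le; positivity)
  have h1 : copiesEnergy q ψ hψ x (2 ^ n) ≤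
      ENNReal.ofReal (2 * 2 ^ (q * δ * n)) * copiesEnergy q ψ hψ x (2 ^ 0) := by
    rw [copiesEnergy, copiesEnergy, ← lintegral_const_mul _ (measurable_psiExt_distribFun hq0 hψ x _)]
    refine lintegral_mono fun s => ?_
    simpa using psiExt_two_pow_mul_le hψ hconc hzero hC hn _
  have h2 := (hx n le_rfl).1.trans (h1.trans (mul_le_mul_right (hx 0 n.zero_le).2 _))
  rw [← ENNReal.ofReal_mul (by positivity), ENNReal.ofReal_le_ofReal_iff (by positivity),
    Real.rpow_neg zero_le_two, inv_mul_le_iff₀ (by positivity)] at h2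
  simp only [Nat.cast_zero, mul_zero, Real.rpow_zero, mul_one] at h2
  linarith

theorem le_recip_of_represented {q : ℝ} (hq : 1 ≤ q) {ψ : ℝ → ℝ} (hψ : MonotoneOn ψ (Ici 0))
    (hconc : ConcaveOn ℝ (Ici 0) ψ) (hzero : ψ 0 = 0) {p : ℝ≥0∞} (hp : 1 ≤ p)
    (hrep : SymmFinitelyRepresented (lorentzNorm q ψ hψ) p) {a : ℝ}
    (hgrow : IsGrowthExponent q (fun (k : ℤ) (_ : ℕ) => ψ ((2 : ℝ) ^ k))
      (fun k n => ψ ((2 : ℝ) ^ (k + n))) (-a)) : a ≤ (p⁻¹).toReal := by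
  have hq0 : 0 < q := by linarith
  rw [← neg_le_neg_iff]
  refine le_of_forall_gt_imp_ge_of_dense fun δ hδ => ?_
  refine le_of_eventually_two_rpow_le (q := q) (K := 2 ^ q * (2 * 2 ^ q)) hq0 ?_
  filter_upwards [hgrow.1 δ hδ] with n hn
  obtain ⟨x, hx⟩ := exists_copiesEnergy_bounds hq hψ hp hrep n
  have h1 : copiesEnergy q ψ hψ x (2 ^ 0) ≤
      ENNReal.ofReal (2 * 2 ^ (q * δ * n)) * copiesEnergy q ψ hψ x (2 ^ n) := by
    rw [copiesEnergy, copiesEnergy, ← lintegral_const_mul _ (measurable_psiExt_distribFun hq0 hψ x _)]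
    refine lintegral_mono fun s => ?_
    simpa using psiExt_le_two_pow_mul hψ hconc hzero (by positivity) hn _
  have h2 := (hx 0 n.zero_le).1.trans (h1.trans (mul_le_mul_right (hx n le_rfl).2 _))
  rw [← ENNReal.ofReal_mul (by positivity), ENNReal.ofReal_le_ofReal_iff (by positivity),
    Real.rpow_neg zero_le_two, inv_mul_le_iff₀ (by positivity)] at h2
  simp only [Nat.cast_zero, mul_zero, Real.rpow_zero] at h2
  have h3 : (0 : ℝ) < 2 ^ (q * (p⁻¹).toReal * n) := by positivity
  rw [show q * -(p⁻¹).toReal * n = -(q * (p⁻¹).toReal * n) by ring, Real.rpow_neg zero_le_two,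
    inv_le_iff_one_le_mul₀ h3]
  linarith

theorem not_represented_of_valley {q : ℝ} (hq : 1 ≤ q) {ψ : ℝ → ℝ} (hψ : MonotoneOn ψ (Ici 0))
    (hconc : ConcaveOn ℝ (Ici 0) ψ) (hzero : ψ 0 = 0) (hpos : ∀ t : ℝ, 0 < t → 0 < ψ t)
    {p : ℝ≥0∞} (hp : 1 ≤ p)
    (hrep : SymmFinitelyRepresented (lorentzNorm q ψ hψ) p) {a b : ℝ} (hb : 0 ≤ b)
    (hinf : IsGrowthExponent q (fun (k : {k : ℤ // 0 ≤ k}) (_ : ℕ) => ψ ((2 : ℝ) ^ (k : ℤ)))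
      (fun k n => ψ ((2 : ℝ) ^ ((k : ℤ) + n))) (-a))
    (hnul : IsGrowthExponent q (fun (k : {k : ℤ // k ≤ 0}) (_ : ℕ) => ψ ((2 : ℝ) ^ (k : ℤ)))
      (fun k n => ψ ((2 : ℝ) ^ ((k : ℤ) - n))) b) (h1 : b < (p⁻¹).toReal) :
    a ≤ (p⁻¹).toReal := by
  have hq0 : 0 < q := by linarith
  by_contra! h2
  set g := (p⁻¹).toReal with hg
  obtain ⟨δ₁, hδ₁, hδ₁g⟩ := exists_between h1
  obtain ⟨δ₂, hδ₂, hδ₂g⟩ := exists_between (neg_lt_neg h2)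
  -- Both energy bounds cost `2 ^ q` and dyadic rounding costs 2. Divided by `2 ^ (q * g * m)`, the
  -- two terms bounding the middle energy decay, because `δ₁ < g < -δ₂`.
  set K : ℝ := 2 ^ q * (2 * 2 ^ q) with hK
  have hKpos : 0 < K := by positivity
  have hlim : Tendsto (fun m : ℕ => K * ((2 : ℝ) ^ (q * (δ₁ - g))) ^ m +
      K * ((2 : ℝ) ^ (q * (δ₂ + g))) ^ m) atTop (𝓝 (K * 0 + K * 0)) := by
    refine ((tendsto_pow_atTop_nhds_zero_of_lt_one (by positivity) ?_).const_mul K).add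
      ((tendsto_pow_atTop_nhds_zero_of_lt_one (by positivity) ?_).const_mul K)
    · exact Real.rpow_lt_one_of_one_lt_of_neg one_lt_two (mul_neg_of_pos_of_neg hq0 (by linarith))
    · exact Real.rpow_lt_one_of_one_lt_of_neg one_lt_two (mul_neg_of_pos_of_neg hq0 (by linarith))
  rw [mul_zero, add_zero] at hlim
  obtain ⟨m, ⟨hm1, hm2⟩, hm3⟩ := (((hnul.1 δ₁ hδ₁).and (hinf.1 δ₂ hδ₂)).and
    (hlim.eventually (gt_mem_nhds one_pos))).exists
  obtain ⟨x, hx⟩ := exists_copiesEnergy_bounds hq hψ hp hrep (2 * m)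
  have hC : (1 : ℝ) ≤ 2 ^ (q * δ₁ * m) :=
    Real.one_le_rpow one_le_two (by have := hb.trans hδ₁.le; positivity)
  have e1 : copiesEnergy q ψ hψ x (2 ^ m) ≤
      ENNReal.ofReal (2 * 2 ^ (q * δ₁ * m)) * copiesEnergy q ψ hψ x (2 ^ 0) +
      ENNReal.ofReal (2 * 2 ^ (q * δ₂ * m)) * copiesEnergy q ψ hψ x (2 ^ (2 * m)) := by
    rw [copiesEnergy, copiesEnergy, copiesEnergy,
      ← lintegral_const_mul _ (measurable_psiExt_distribFun hq0 hψ x _),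
      ← lintegral_const_mul _ (measurable_psiExt_distribFun hq0 hψ x _),
      ← lintegral_add_left ((measurable_psiExt_distribFun hq0 hψ x _).const_mul _)]
    refine lintegral_mono fun s => ?_
    simpa using psiExt_two_pow_mul_le_add hψ hconc hzero hC (by positivity) hpos
      (fun k hk => hm1 ⟨k, hk⟩) (fun k hk => hm2 ⟨k, hk⟩) _
  have e2 := (hx m (by omega)).1.trans (e1.trans (add_le_add
    (mul_le_mul_right (hx 0 (by omega)).2 _) (mul_le_mul_right (hx (2 * m) le_rfl).2 _)))
  rw [← ENNReal.ofReal_mul (by positivity), ← ENNReal.ofReal_mul (by positivity),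
    ← ENNReal.ofReal_add (by positivity) (by positivity),
    ENNReal.ofReal_le_ofReal_iff (by positivity),
    Real.rpow_neg zero_le_two, inv_mul_le_iff₀ (by positivity)] at e2
  simp only [Nat.cast_zero, mul_zero, Real.rpow_zero, mul_one] at e2
  rw [← Real.rpow_mul_natCast zero_le_two, ← Real.rpow_mul_natCast zero_le_two] at hm3
  have h3 : (0 : ℝ) < 2 ^ (q * g * m) := by positivity
  have e3 := mul_lt_mul_of_pos_right hm3 h3
  have e4 : (2 : ℝ) ^ (q * (δ₁ - g) * m) * 2 ^ (q * g * m) = 2 ^ (q * δ₁ * m) := by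
    rw [← Real.rpow_add two_pos]; ring_nf
  have e5 : (2 : ℝ) ^ (q * (δ₂ + g) * m) * 2 ^ (q * g * m) =
      2 ^ (q * δ₂ * m) * 2 ^ (q * g * (2 * m : ℕ)) := by
    rw [← Real.rpow_add two_pos, ← Real.rpow_add two_pos]; push_cast; ring_nf
  rw [add_mul, mul_assoc K, e4, mul_assoc K, e5, one_mul, hK] at e3
  linarith

/-! ### Sufficiency: disjoint translates -/

theorem psiExt_add_le {ψ : ℝ → ℝ} (hψ : MonotoneOn ψ (Ici 0)) (hconc : ConcaveOn ℝ (Ici 0) ψ)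
    (hzero : ψ 0 = 0) (D₁ D₂ : ℝ≥0∞) :
    psiExt ψ hψ (D₁ + D₂) ≤ psiExt ψ hψ D₁ + psiExt ψ hψ D₂ := by
  rcases eq_or_ne D₁ ∞ with rfl | h1
  · simp
  rcases eq_or_ne D₂ ∞ with rfl | h2
  · simp
  rw [← ENNReal.ofReal_toReal h1, ← ENNReal.ofReal_toReal h2,
    ← ENNReal.ofReal_add ENNReal.toReal_nonneg ENNReal.toReal_nonneg,
    psiExt_ofReal hψ hconc hzero ENNReal.toReal_nonneg,
    psiExt_ofReal hψ hconc hzero ENNReal.toReal_nonneg,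
    psiExt_ofReal hψ hconc hzero (add_nonneg ENNReal.toReal_nonneg ENNReal.toReal_nonneg)]
  exact (ENNReal.ofReal_le_ofReal (add_le_of_concaveOn_of_zero hconc hzero
    ENNReal.toReal_nonneg ENNReal.toReal_nonneg)).trans ENNReal.ofReal_add_le

theorem psiExt_natCast_mul_le {ψ : ℝ → ℝ} (hψ : MonotoneOn ψ (Ici 0))
    (hconc : ConcaveOn ℝ (Ici 0) ψ) (hzero : ψ 0 = 0) (n : ℕ) (D : ℝ≥0∞) :
    psiExt ψ hψ (n * D) ≤ n * psiExt ψ hψ D := by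
  induction n with
  | zero => simp [psiExt_zero]
  | succ n ih =>
    push_cast
    rw [add_mul, add_mul, one_mul, one_mul]
    exact (psiExt_add_le hψ hconc hzero _ _).trans (add_le_add_left ih _)

theorem distribFun_const_mul {c : ℝ} (hc : c ≠ 0) (x : ℝ → ℝ) (τ : ℝ≥0∞) :
    distribFun (fun t => c * x t) τ = distribFun x (τ / ENNReal.ofReal |c|) := by
  have hc' : ENNReal.ofReal |c| ≠ 0 := (ENNReal.ofReal_pos.2 (abs_pos.2 hc)).ne'
  simp only [distribFun, abs_mul, ENNReal.ofReal_mul (abs_nonneg c)]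
  congr 1
  ext s
  simp only [mem_ofPred_eq, and_congr_right_iff]
  intro _
  rw [ENNReal.div_lt_iff (Or.inl hc') (Or.inl ENNReal.ofReal_ne_top), mul_comm]

theorem rearrangement_const_mul (c : ℝ) (x : ℝ → ℝ) (t : ℝ) :
    rearrangement (fun t => c * x t) t = ENNReal.ofReal |c| * rearrangement x t := by
  rcases eq_or_ne c 0 with rfl | hc
  · simp [rearrangement, distribFun]
  have hc' : ENNReal.ofReal |c| ≠ 0 := (ENNReal.ofReal_pos.2 (abs_pos.2 hc)).ne'
  refine eq_of_forall_lt_iff fun τ => ?_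
  rw [lt_rearrangement_iff, distribFun_const_mul hc, ← lt_rearrangement_iff,
    ENNReal.div_lt_iff (Or.inl hc') (Or.inl ENNReal.ofReal_ne_top), mul_comm]

theorem lorentzNorm_const_mul {q : ℝ} (hq : 0 < q) {ψ : ℝ → ℝ} (hψ : MonotoneOn ψ (Ici 0))
    (c : ℝ) (x : ℝ → ℝ) :
    lorentzNorm q ψ hψ (fun t => c * x t) = ENNReal.ofReal |c| * lorentzNorm q ψ hψ x := by
  simp only [lorentzNorm, rearrangement_const_mul, ENNReal.mul_rpow_of_nonneg _ _ hq.le]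
  rw [lintegral_const_mul _ ((rearrangement_anti x).measurable.pow_const q),
    ENNReal.mul_rpow_of_nonneg _ _ (by positivity), one_div, ENNReal.rpow_rpow_inv hq.ne']

theorem equimeasurable_of_distribFun_eq {x y : ℝ → ℝ}
    (h : ∀ τ, distribFun x τ = distribFun y τ) : Equimeasurable x y := fun τ hτ => by
  have := h (ENNReal.ofReal τ)
  simpa only [distribFun, ENNReal.ofReal_lt_ofReal_iff_of_nonneg hτ.le] using this

theorem distribFun_translate {f : ℝ → ℝ} {L u : ℝ} (hu : 0 ≤ u)
    (hf : ∀ t, t ∉ Ioc 0 L → f t = 0) (τ : ℝ≥0∞) :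
    distribFun (fun t => f (t + -u)) τ = distribFun f τ := by
  have : {s : ℝ | 0 < s ∧ τ < ENNReal.ofReal |f (s + -u)|} =
      (fun s => s + -u) ⁻¹' {s : ℝ | 0 < s ∧ τ < ENNReal.ofReal |f s|} := by
    ext s
    simp only [mem_preimage, mem_ofPred_eq, and_congr_left_iff]
    intro h
    have hs : s + -u ∈ Ioc 0 L := by
      by_contra hcon
      simp [hf _ hcon] at h
    exact ⟨fun _ => hs.1, fun _ => by linarith [hs.1]⟩
  rw [distribFun, this, measure_preimage_add_right]
  rfl

theorem norm_toLp_inv_norm_mul {p : ℝ≥0∞} (hp : 1 ≤ p) {n : ℕ} {a : Fin n → ℝ}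
    (ha : ‖(WithLp.toLp p a : PiLp p fun _ : Fin n => ℝ)‖ ≠ 0) :
    ‖(WithLp.toLp p (fun k => ‖(WithLp.toLp p a : PiLp p fun _ : Fin n => ℝ)‖⁻¹ * a k) :
      PiLp p fun _ : Fin n => ℝ)‖ = 1 := by
  have : Fact (1 ≤ p) := ⟨hp⟩
  have h : (WithLp.toLp p (fun k => ‖(WithLp.toLp p a : PiLp p fun _ : Fin n => ℝ)‖⁻¹ * a k) :
      PiLp p fun _ : Fin n => ℝ) = ‖(WithLp.toLp p a : PiLp p fun _ : Fin n => ℝ)‖⁻¹ •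
        (WithLp.toLp p a : PiLp p fun _ : Fin n => ℝ) := rfl
  rw [h, norm_smul, norm_inv, norm_norm, inv_mul_cancel₀ ha]

/-- Translates of one profile by multiples of `L` are disjoint and equimeasurable, and homogeneity
reduces the norm estimate to unit vectors. What remains is that the energy be nearly independent of
the unit vector; its value `E` is normalised away. -/
theorem represented_of_translates {q : ℝ} (hq : 1 ≤ q) {ψ : ℝ → ℝ} (hψ : MonotoneOn ψ (Ici 0))
    {p : ℝ≥0∞} (hp : 1 ≤ p)
    (h : ∀ (n : ℕ) (η : ℝ), 0 < η → ∃ (f : ℝ → ℝ) (L E : ℝ), Measurable f ∧ 0 ≤ L ∧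
      (∀ t, t ∉ Ioc 0 L → f t = 0) ∧ 0 < E ∧ ∀ c : Fin n → ℝ,
        ‖(WithLp.toLp p c : PiLp p fun _ : Fin n => ℝ)‖ = 1 →
        ENNReal.ofReal ((1 - η) * E) ≤ (∫⁻ s in Ioi (0 : ℝ), psiExt ψ hψ
          (∑ k, distribFun (fun t => c k * f t) (ENNReal.ofReal s ^ (1 / q)))) ∧
        (∫⁻ s in Ioi (0 : ℝ), psiExt ψ hψ
          (∑ k, distribFun (fun t => c k * f t) (ENNReal.ofReal s ^ (1 / q)))) ≤
          ENNReal.ofReal ((1 + η) * E)) :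
    SymmFinitelyRepresented (lorentzNorm q ψ hψ) p := by
  have hq0 : 0 < q := by linarith
  intro n ε hε
  -- With this `η`, `1 - η` equals `(1 + ε)⁻¹` and `1 + η ≤ 1 + ε`; since `q ≥ 1`, both survive
  -- taking the `q`-th root.
  obtain ⟨f, L, E, hfm, hL, hf, hE, hbd⟩ := h n (ε / (1 + ε)) (by positivity)
  set l : ℝ := (E ^ q⁻¹)⁻¹ with hl
  have hl0 : 0 < l := by positivity
  set y : Fin n → ℝ → ℝ := fun (k : Fin n) t => f (t + -((k : ℕ) * L))
  have hym : ∀ k, Measurable (y k) := fun k => by fun_prop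
  have hysupp : ∀ (k : Fin n) (t : ℝ), t + -((k : ℕ) * L) ∉ Ioc 0 L → y k t = 0 := fun k t ht => hf _ ht
  have hydisj : ∀ i j : Fin n, i ≠ j → ∀ t, y i t = 0 ∨ y j t = 0 := by
    have key : ∀ i j : Fin n, i < j → ∀ t, y i t = 0 ∨ y j t = 0 := fun i j hij t => by
      by_contra! hcon
      have hi : t + -((i : ℕ) * L) ∈ Ioc 0 L := by
        by_contra h'; exact hcon.1 (hysupp i t h')
      have hj : t + -((j : ℕ) * L) ∈ Ioc 0 L := by
        by_contra h'; exact hcon.2 (hysupp j t h')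
      have : ((i : ℕ) : ℝ) + 1 ≤ (j : ℕ) := by exact_mod_cast hij
      have := mul_le_mul_of_nonneg_right this hL
      linarith [hi.2, hj.1]
    intro i j hij t
    rcases lt_or_gt_of_ne hij with h' | h'
    · exact key i j h' t
    · exact (key j i h' t).symm
  have hydist : ∀ (k : Fin n) (c : ℝ) (τ : ℝ≥0∞),
      distribFun (fun t => c * y k t) τ = distribFun (fun t => c * f t) τ := fun k c τ =>
    distribFun_translate (f := fun t => c * f t) (L := L) (by positivity)
      (fun t ht => by rw [hf t ht, mul_zero]) τ
  have hmain : ∀ a : Fin n → ℝ,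
      ENNReal.ofReal ((1 + ε)⁻¹ * ‖(WithLp.toLp p a : PiLp p fun _ : Fin n => ℝ)‖) ≤
        lorentzNorm q ψ hψ (fun t => ∑ k, a k * (l * y k t)) ∧
      lorentzNorm q ψ hψ (fun t => ∑ k, a k * (l * y k t)) ≤
        ENNReal.ofReal ((1 + ε) * ‖(WithLp.toLp p a : PiLp p fun _ : Fin n => ℝ)‖) := by
    intro a
    have hFact : Fact (1 ≤ p) := ⟨hp⟩
    set A : ℝ := ‖(WithLp.toLp p a : PiLp p fun _ : Fin n => ℝ)‖ with hA
    have hA0 : 0 ≤ A := norm_nonneg _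
    rcases eq_or_ne A 0 with h0 | h0
    · have ha : a = 0 := by
        have := norm_eq_zero.1 h0
        simpa using this
      have hz : lorentzNorm q ψ hψ (fun t => ∑ k, a k * (l * y k t)) = 0 := by
        have := lorentzNorm_const_mul hq0 hψ 0 (fun _ => 0)
        simpa [ha] using this
      rw [hz, h0]; simp
    set c : Fin n → ℝ := fun k => A⁻¹ * a k with hc
    have hc1 := hbd c (norm_toLp_inv_norm_mul hp h0)
    have hfun : (fun t => ∑ k, a k * (l * y k t)) = fun t => (l * A) * ∑ k, c k * y k t := by
      funext t
      rw [Finset.mul_sum]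
      refine Finset.sum_congr rfl fun k _ => ?_
      simp only [hc]
      field_simp
    have hpow : lorentzNorm q ψ hψ (fun t => ∑ k, c k * y k t) ^ q =
        ∫⁻ s in Ioi (0 : ℝ), psiExt ψ hψ
          (∑ k, distribFun (fun t => c k * f t) (ENNReal.ofReal s ^ (1 / q))) := by
      rw [lorentzNorm_rpow hq0]
      refine lintegral_congr fun s => ?_
      rw [distribFun_sum (fun k => (hym k).aemeasurable)
        (fun i j hij => Eventually.of_forall (hydisj i j hij))]
      simp only [hydist]
    rw [← hpow] at hc1
    have hback : ∀ z : ℝ≥0∞, (z ^ q) ^ q⁻¹ = z := fun z => ENNReal.rpow_rpow_inv hq0.ne' z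
    have hqinv : 0 ≤ q⁻¹ := by positivity
    have hq1 : (1 + ε) ≤ (1 + ε) ^ q := by
      conv_lhs => rw [← Real.rpow_one (1 + ε)]
      exact Real.rpow_le_rpow_of_exponent_le (by linarith) hq
    have hup : (1 + ε / (1 + ε)) ≤ (1 + ε) ^ q := by
      refine le_trans ?_ hq1
      gcongr
      exact div_le_self hε.le (by linarith)
    have hlow : ((1 + ε)⁻¹) ^ q ≤ 1 - ε / (1 + ε) := by
      rw [Real.inv_rpow (by positivity), show 1 - ε / (1 + ε) = (1 + ε)⁻¹ by field_simp; ring]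
      exact inv_anti₀ (by positivity) hq1
    have hroot : ∀ d : ℝ, 0 ≤ d → (d ^ q * E) ^ q⁻¹ = d * E ^ q⁻¹ := fun d hd => by
      rw [Real.mul_rpow (by positivity) hE.le, Real.rpow_rpow_inv hd hq0.ne']
    have hlE : l * E ^ q⁻¹ = 1 := inv_mul_cancel₀ (by positivity)
    rw [hfun, lorentzNorm_const_mul hq0, abs_of_nonneg (by positivity)]
    constructor
    · have h1 : ENNReal.ofReal (((1 + ε)⁻¹) ^ q * E) ^ q⁻¹ ≤ _ := ENNReal.rpow_le_rpow
        ((ENNReal.ofReal_le_ofReal (mul_le_mul_of_nonneg_right hlow hE.le)).trans hc1.1) hqinv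
      rw [hback, ENNReal.ofReal_rpow_of_nonneg (by positivity) hqinv, hroot _ (by positivity)] at h1
      refine le_trans (le_of_eq ?_) (mul_le_mul_right h1 _)
      rw [← ENNReal.ofReal_mul (by positivity)]
      congr 1
      linear_combination (-(1 + ε)⁻¹ * A) * hlE
    · have h1 : _ ≤ ENNReal.ofReal ((1 + ε) ^ q * E) ^ q⁻¹ := ENNReal.rpow_le_rpow
        (hc1.2.trans (ENNReal.ofReal_le_ofReal (mul_le_mul_of_nonneg_right hup hE.le))) hqinv
      rw [hback, ENNReal.ofReal_rpow_of_nonneg (by positivity) hqinv, hroot _ (by positivity)] at h1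
      refine (mul_le_mul_right h1 _).trans (le_of_eq ?_)
      rw [← ENNReal.ofReal_mul (by positivity)]
      congr 1
      linear_combination ((1 + ε) * A) * hlE
  refine ⟨fun k t => l * y k t, fun k => ⟨((hym k).const_mul l).aemeasurable, ?_⟩, fun i j => ?_,
    fun i j hij => ?_, hmain⟩
  · have := (hmain (Pi.single k 1)).2
    simp only [Pi.single_apply, ite_mul, one_mul, zero_mul, Finset.sum_ite_eq',
      Finset.mem_univ, if_true] at this
    exact this.trans_lt ENNReal.ofReal_lt_top
  · exact equimeasurable_of_distribFun_eq fun τ => by rw [hydist, hydist]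
  · refine Eventually.of_forall fun t => ?_
    rcases hydisj i j hij t with h' | h'
    · left; simp only [h', mul_zero]
    · right; simp only [h', mul_zero]

/-! ### Sufficiency: characteristic functions and truncated powers -/

theorem setLIntegral_indicator_Iio_const {B : ℝ} (c : ℝ≥0∞) :
    ∫⁻ s in Ioi (0 : ℝ), (Iio B).indicator (fun _ => c) s = c * ENNReal.ofReal B := by
  rw [lintegral_indicator_const measurableSet_Iio, Measure.restrict_apply measurableSet_Iio,
    inter_comm, Ioi_inter_Iio, Real.volume_Ioo, sub_zero]

/-- For coefficients of sup norm 1, the distribution of a sum of disjoint indicators lies between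
`L` and `n * L` below level 1 and vanishes from level 1 on. So the energy lies between `ψ L` and `ψ
(n * L)`. -/
theorem represented_top {q : ℝ} (hq : 1 ≤ q) {ψ : ℝ → ℝ} (hψ : MonotoneOn ψ (Ici 0))
    (hconc : ConcaveOn ℝ (Ici 0) ψ) (hzero : ψ 0 = 0) (hpos : ∀ t : ℝ, 0 < t → 0 < ψ t)
    (hflat : ∀ (n : ℕ) (η : ℝ), 0 < η → ∃ L : ℝ, 0 < L ∧ ψ (n * L) ≤ (1 + η) * ψ L) :
    SymmFinitelyRepresented (lorentzNorm q ψ hψ) ∞ := by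
  have hq0 : 0 < q := by linarith
  refine represented_of_translates hq hψ le_top fun n η hη => ?_
  obtain ⟨L, hL, hflatL⟩ := hflat n η hη
  refine ⟨(Ioc 0 L).indicator 1, L, ψ L, measurable_one.indicator measurableSet_Ioc, hL.le,
    fun t ht => indicator_of_notMem ht _, hpos L hL, fun c hc => ?_⟩
  have hn : Nonempty (Fin n) := by
    by_contra hne
    rw [not_nonempty_iff] at hne
    rw [PiLp.norm_eq_ciSup, Real.iSup_of_isEmpty] at hc
    exact zero_ne_one hc
  have hle : ∀ k, |c k| ≤ 1 := fun k => by
    rw [← hc, PiLp.norm_eq_ciSup]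
    exact le_ciSup (f := fun k => ‖c k‖) (finite_range _).bddAbove k
  obtain ⟨k₀, hk₀⟩ : ∃ k, |c k| = 1 := by
    obtain ⟨k, hk⟩ := exists_eq_ciSup_of_finite (f := fun k => ‖c k‖)
    refine ⟨k, ?_⟩
    rw [← Real.norm_eq_abs, hk, ← hc, PiLp.norm_eq_ciSup]
  have hup : ∀ k τ, distribFun (fun t => c k * (Ioc 0 L).indicator 1 t) τ ≤
      ENNReal.ofReal L := fun k τ => by
    refine (measure_mono (t := Ioc 0 L) fun s hs => ?_).trans (by rw [Real.volume_Ioc, sub_zero])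
    by_contra hcon
    simp [indicator_of_notMem hcon] at hs
  have hz : ∀ k τ, 1 ≤ τ → distribFun (fun t => c k * (Ioc 0 L).indicator 1 t) τ = 0 :=
      fun k τ hτ => by
    have : {s : ℝ | 0 < s ∧ τ < ENNReal.ofReal |c k * (Ioc 0 L).indicator 1 s|} = ∅ := by
      refine eq_empty_of_forall_notMem fun s hs => ?_
      refine (hs.2.trans_le ?_).not_ge hτ
      refine ENNReal.ofReal_le_one.2 ?_
      rw [abs_mul]
      refine mul_le_one₀ (hle k) (abs_nonneg _) ?_
      by_cases hsL : s ∈ Ioc 0 L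
      · simp [indicator_of_mem hsL]
      · simp [indicator_of_notMem hsL]
    rw [distribFun, this, measure_empty]
  have hlow : ∀ τ, τ < 1 → ENNReal.ofReal L ≤
      distribFun (fun t => c k₀ * (Ioc 0 L).indicator 1 t) τ := fun τ hτ => by
    refine le_trans (by rw [Real.volume_Ioc, sub_zero]) (measure_mono (s := Ioc 0 L) fun s hs => ?_)
    refine ⟨hs.1, ?_⟩
    change τ < ENNReal.ofReal |c k₀ * (Ioc 0 L).indicator 1 s|
    rw [indicator_of_mem hs, abs_mul, hk₀]
    simpa using hτ
  constructor
  · calc ENNReal.ofReal ((1 - η) * ψ L) ≤ psiExt ψ hψ (ENNReal.ofReal L) := by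
          rw [psiExt_ofReal hψ hconc hzero hL.le]
          refine ENNReal.ofReal_le_ofReal ?_
          nlinarith [hpos L hL]
      _ = ∫⁻ s in Ioi (0 : ℝ), (Iio 1).indicator (fun _ => psiExt ψ hψ (ENNReal.ofReal L)) s := by
          rw [setLIntegral_indicator_Iio_const, ENNReal.ofReal_one, mul_one]
      _ ≤ _ := by
          refine lintegral_mono fun s => ?_
          by_cases hs : s ∈ Iio (1 : ℝ)
          swap
          · rw [indicator_of_notMem hs]; exact zero_le
          rw [indicator_of_mem hs]
          refine psiExt_mono hψ ?_
          refine (hlow (ENNReal.ofReal s ^ (1 / q)) (ENNReal.rpow_lt_one ?_ (by positivity))).trans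
            (Finset.single_le_sum (f := fun k => distribFun
              (fun t => c k * (Ioc 0 L).indicator 1 t) (ENNReal.ofReal s ^ (1 / q)))
              (fun _ _ => zero_le) (Finset.mem_univ k₀))
          simpa using hs
  · calc _ ≤ ∫⁻ s in Ioi (0 : ℝ),
          (Iio 1).indicator (fun _ => psiExt ψ hψ (n * ENNReal.ofReal L)) s := by
          refine lintegral_mono fun s => ?_
          by_cases hs : s ∈ Iio (1 : ℝ)
          · rw [indicator_of_mem hs]
            refine psiExt_mono hψ ((Finset.sum_le_sum fun k _ => hup k _).trans ?_)
            simp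
          · rw [indicator_of_notMem hs]
            have : (1 : ℝ≥0∞) ≤ ENNReal.ofReal s ^ (1 / q) := by
              refine ENNReal.one_le_rpow ?_ (by positivity)
              rw [← ENNReal.ofReal_one]
              exact ENNReal.ofReal_le_ofReal (not_lt.1 hs)
            simp only [hz _ _ this, Finset.sum_const_zero, psiExt_zero, le_refl]
      _ = ENNReal.ofReal (ψ (n * L)) := by
          rw [setLIntegral_indicator_Iio_const, ENNReal.ofReal_one, mul_one,
            ← psiExt_ofReal hψ hconc hzero (by positivity), ENNReal.ofReal_mul (by positivity),
            ENNReal.ofReal_natCast]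
      _ ≤ _ := ENNReal.ofReal_le_ofReal hflatL

/-- The power `t ^ (-1 / P)`, truncated at `M` and supported in `(0, L]`. -/
noncomputable def truncPower (P M L : ℝ) : ℝ → ℝ :=
  (Ioc 0 L).indicator fun t => (max t M) ^ (-P⁻¹)

theorem measurable_truncPower (P M L : ℝ) : Measurable (truncPower P M L) :=
  Measurable.indicator (by fun_prop) measurableSet_Ioc

theorem mem_of_lt_truncPower {P M L c τ t : ℝ} (hτ : 0 < τ) (h : τ < |c * truncPower P M L t|) :
    t ∈ Ioc 0 L ∧ τ < |c| * (max t M) ^ (-P⁻¹) := by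
  have ht : t ∈ Ioc 0 L := by
    by_contra hcon
    simp [truncPower, indicator_of_notMem hcon] at h
    linarith
  refine ⟨ht, ?_⟩
  rwa [truncPower, indicator_of_mem ht, abs_mul,
    abs_of_nonneg (Real.rpow_nonneg (ht.1.le.trans (le_max_left _ _)) _)] at h

theorem distribFun_ofReal {x : ℝ → ℝ} {τ : ℝ} (hτ : 0 ≤ τ) :
    distribFun x (ENNReal.ofReal τ) = volume {s : ℝ | 0 < s ∧ τ < |x s|} := by
  simp only [distribFun, ENNReal.ofReal_lt_ofReal_iff_of_nonneg hτ]

theorem distribFun_truncPower_le {P M L c τ : ℝ} (hP : 0 < P) (hτ : 0 < τ) :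
    distribFun (fun t => c * truncPower P M L t) (ENNReal.ofReal τ) ≤
      ENNReal.ofReal ((|c| / τ) ^ P) := by
  rw [distribFun_ofReal hτ.le]
  refine (measure_mono (t := Ioo 0 ((|c| / τ) ^ P)) fun t ht => ?_).trans
    (by rw [Real.volume_Ioo, sub_zero])
  obtain ⟨h1, h2⟩ := mem_of_lt_truncPower hτ ht.2
  have h3 : (max t M) ^ (-P⁻¹) ≤ t ^ (-P⁻¹) :=
    Real.rpow_le_rpow_of_nonpos h1.1 (le_max_left _ _) (by simp [hP.le])
  have h4 : τ < |c| * t ^ (-P⁻¹) := h2.trans_le (mul_le_mul_of_nonneg_left h3 (abs_nonneg c))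
  refine ⟨h1.1, ?_⟩
  have h5 : 0 < t ^ P⁻¹ := Real.rpow_pos_of_pos h1.1 _
  rw [Real.rpow_neg h1.1.le, ← div_eq_mul_inv, lt_div_iff₀ h5, mul_comm, ← lt_div_iff₀ hτ] at h4
  exact (Real.rpow_inv_lt_iff_of_pos h1.1.le (by positivity) hP).1 h4

theorem distribFun_truncPower_le_length {P M L c τ : ℝ} (hτ : 0 < τ) :
    distribFun (fun t => c * truncPower P M L t) (ENNReal.ofReal τ) ≤ ENNReal.ofReal L := by
  rw [distribFun_ofReal hτ.le]
  exact (measure_mono (t := Ioc 0 L) fun t ht => (mem_of_lt_truncPower hτ ht.2).1).trans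
    (by rw [Real.volume_Ioc, sub_zero])

theorem distribFun_truncPower_eq_zero {P M L c τ : ℝ} (hP : 0 < P) (hτ : 0 < τ) (hM : 0 < M)
    (hc : |c| ≤ 1) (h : τ ^ (-P) ≤ M) :
    distribFun (fun t => c * truncPower P M L t) (ENNReal.ofReal τ) = 0 := by
  rw [distribFun_ofReal hτ.le]
  refine measure_mono_null (t := ∅) (fun t ht => ?_) measure_empty
  obtain ⟨h1, h2⟩ := mem_of_lt_truncPower hτ ht.2
  have h3 : (max t M) ^ (-P⁻¹) ≤ M ^ (-P⁻¹) :=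
    Real.rpow_le_rpow_of_nonpos hM (le_max_right _ _) (by simp [hP.le])
  have h4 : M ^ (-P⁻¹) ≤ τ := by
    rw [← inv_neg]; exact (Real.rpow_inv_le_iff_of_neg hM hτ (by linarith)).2 h
  have h5 : 0 < (max t M) ^ (-P⁻¹) := Real.rpow_pos_of_pos (hM.trans_le (le_max_right _ _)) _
  have h6 : |c| * (max t M) ^ (-P⁻¹) ≤ 1 * (max t M) ^ (-P⁻¹) :=
    mul_le_mul_of_nonneg_right hc h5.le
  exact absurd h2 (by linarith)

/-- The untruncated power has distribution `(|c| / τ) ^ P`. If this is at most `M`, the error term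
absorbs it; otherwise the cap is not felt at level `τ`, and `h` keeps the level set inside the
support. -/
theorem le_distribFun_truncPower {P M L c τ : ℝ} (hP : 0 < P) (hτ : 0 < τ) (hM : 0 < M)
    (hc : |c| ≤ 1) (h : τ ^ (-P) ≤ L) : ENNReal.ofReal ((|c| / τ) ^ P) ≤
      distribFun (fun t => c * truncPower P M L t) (ENNReal.ofReal τ) + ENNReal.ofReal M := by
  rcases le_or_gt ((|c| / τ) ^ P) M with hX | hX
  · exact (ENNReal.ofReal_le_ofReal hX).trans le_add_self
  refine le_add_right ?_
  rw [distribFun_ofReal hτ.le]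
  refine le_trans (by rw [Real.volume_Ioo, sub_zero])
    (measure_mono (s := Ioo 0 ((|c| / τ) ^ P)) fun t ht => ⟨ht.1, ?_⟩)
  have hXL : (|c| / τ) ^ P ≤ L := by
    refine le_trans ?_ h
    rw [Real.rpow_neg hτ.le, ← Real.inv_rpow hτ.le]
    refine Real.rpow_le_rpow (by positivity) ?_ hP.le
    rw [div_eq_mul_inv]
    exact mul_le_of_le_one_left (by positivity) hc
  have hmem : t ∈ Ioc 0 L := ⟨ht.1, ht.2.le.trans hXL⟩
  have hmax0 : 0 < max t M := hM.trans_le (le_max_right _ _)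
  rw [truncPower, indicator_of_mem hmem, abs_mul, abs_of_nonneg (Real.rpow_nonneg hmax0.le _),
    Real.rpow_neg hmax0.le, ← div_eq_mul_inv, lt_div_iff₀ (Real.rpow_pos_of_pos hmax0 _), mul_comm,
    ← lt_div_iff₀ hτ]
  exact (Real.rpow_inv_lt_iff_of_pos hmax0.le (by positivity) hP).2 (max_lt ht.2 hX)

/-- The block of `s` from `2^(-γ(k+1))` to `2^(-γ k)` has length `(1 - 2^(-γ)) 2^(-γ k)`, and
`s^(-1/γ) ≥ 2^k` on it. -/
theorem sum_le_lintegral_psiExt {ψ : ℝ → ℝ} (hψ : MonotoneOn ψ (Ici 0))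
    (hconc : ConcaveOn ℝ (Ici 0) ψ) (hzero : ψ 0 = 0) (hpos : ∀ t : ℝ, 0 < t → 0 < ψ t)
    {γ : ℝ} (hγ : 0 < γ) (a : ℤ) (N : ℕ) :
    ENNReal.ofReal ((1 - 2 ^ (-γ)) *
      ∑ i ∈ Finset.range N, (2 : ℝ) ^ (-(γ * (a + i : ℤ))) * ψ ((2 : ℝ) ^ (a + i))) ≤
      ∫⁻ s in Ico ((2 : ℝ) ^ (-(γ * (a + N : ℤ)))) ((2 : ℝ) ^ (-(γ * a))),
        psiExt ψ hψ (ENNReal.ofReal (s ^ (-γ⁻¹))) := by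
  have hfac : 0 ≤ 1 - (2 : ℝ) ^ (-γ) :=
    sub_nonneg.2 (Real.rpow_le_one_of_one_le_of_nonpos one_le_two (by linarith))
  induction N with
  | zero => simp
  | succ N ih =>
    set c₀ : ℝ := (2 : ℝ) ^ (-(γ * a)) with hc₀
    set c₁ : ℝ := (2 : ℝ) ^ (-(γ * (a + N : ℤ))) with hc₁
    set c₂ : ℝ := (2 : ℝ) ^ (-(γ * (a + (N + 1 : ℕ) : ℤ))) with hc₂
    have h12 : c₂ = 2 ^ (-γ) * c₁ := by
      rw [hc₂, hc₁, ← Real.rpow_add two_pos]; push_cast; ring_nf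
    have h21 : c₂ ≤ c₁ := Real.rpow_le_rpow_of_exponent_le one_le_two (by push_cast; nlinarith)
    have h10 : c₁ ≤ c₀ := by
      refine Real.rpow_le_rpow_of_exponent_le one_le_two ?_
      have : (0 : ℝ) ≤ γ * N := by positivity
      push_cast; nlinarith
    rw [← Ico_union_Ico_eq_Ico h21 h10, lintegral_union measurableSet_Ico
      (Ico_disjoint_Ico_same), Finset.sum_range_succ, mul_add, add_comm]
    have hψ0 := (hpos ((2 : ℝ) ^ (a + (N : ℤ))) (by positivity)).le
    rw [ENNReal.ofReal_add (mul_nonneg hfac (mul_nonneg (by positivity) hψ0))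
      (mul_nonneg hfac (Finset.sum_nonneg fun i _ => mul_nonneg (by positivity)
        (hpos _ (by positivity)).le))]
    refine add_le_add ?_ ih
    calc ENNReal.ofReal ((1 - 2 ^ (-γ)) * (c₁ * ψ ((2 : ℝ) ^ (a + (N : ℤ)))))
        = ENNReal.ofReal (ψ ((2 : ℝ) ^ (a + (N : ℤ)))) * volume (Ico c₂ c₁) := by
          rw [Real.volume_Ico, ← ENNReal.ofReal_mul hψ0, h12]
          congr 1; ring
      _ = ∫⁻ _ in Ico c₂ c₁, ENNReal.ofReal (ψ ((2 : ℝ) ^ (a + (N : ℤ)))) := by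
          rw [setLIntegral_const]
      _ ≤ _ := by
          refine setLIntegral_mono' measurableSet_Ico fun s hs => ?_
          have hs0 : 0 < s := (by positivity : 0 < c₂).trans_le hs.1
          rw [psiExt_ofReal hψ hconc hzero (by positivity)]
          refine ENNReal.ofReal_le_ofReal (hψ (mem_Ici.2 (by positivity))
            (mem_Ici.2 (by positivity)) ?_)
          have h3 := Real.rpow_le_rpow_of_nonpos hs0 hs.2.le (show -γ⁻¹ ≤ 0 by simp [hγ.le])
          refine le_trans (le_of_eq ?_) h3
          rw [hc₁, ← Real.rpow_mul zero_le_two, ← Real.rpow_intCast]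
          congr 1
          field_simp

theorem sum_abs_rpow_of_norm_eq_one {p : ℝ≥0∞} (hp : 1 ≤ p) (hp' : p ≠ ∞) {n : ℕ} {c : Fin n → ℝ}
    (hc : ‖(WithLp.toLp p c : PiLp p fun _ : Fin n => ℝ)‖ = 1) :
    ∑ k, |c k| ^ p.toReal = 1 := by
  have hp0 : 0 < p.toReal := ENNReal.toReal_pos (by positivity) hp'
  have hs : 0 ≤ ∑ k, |c k| ^ p.toReal := Finset.sum_nonneg fun k _ => by positivity
  rw [PiLp.norm_eq_sum hp0] at hc
  simp only [Real.norm_eq_abs] at hc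
  rw [one_div, Real.rpow_inv_eq hs zero_le_one hp0.ne', Real.one_rpow] at hc
  exact hc

theorem represented_of_intervals {q : ℝ} (hq : 1 ≤ q) {ψ : ℝ → ℝ} (hψ : MonotoneOn ψ (Ici 0))
    (hconc : ConcaveOn ℝ (Ici 0) ψ) (hzero : ψ 0 = 0) (hpos : ∀ t : ℝ, 0 < t → 0 < ψ t)
    {p : ℝ≥0∞} (hp : 1 ≤ p) (hp' : p ≠ ∞) {γ : ℝ} (hγ : γ = q * (p⁻¹).toReal)
    (hint : ∀ ε > 0, ∃ (a : ℤ) (n : ℕ), (2 : ℝ) ^ (-(γ * a)) * ψ ((2 : ℝ) ^ a) +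
        (2 : ℝ) ^ (-(γ * (a + n : ℤ))) * ψ ((2 : ℝ) ^ (a + n)) ≤
      ε * ∑ i ∈ Finset.range n, (2 : ℝ) ^ (-(γ * (a + i : ℤ))) * ψ ((2 : ℝ) ^ (a + i))) :
    SymmFinitelyRepresented (lorentzNorm q ψ hψ) p := by
  have hq0 : 0 < q := by linarith
  set P : ℝ := p.toReal with hP
  have hP0 : 0 < P := ENNReal.toReal_pos (by positivity) hp'
  have hγP : γ = q / P := by rw [hγ, ENNReal.toReal_inv, ← hP, div_eq_mul_inv]
  have hγ0 : 0 < γ := by rw [hγP]; positivity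
  refine represented_of_translates hq hψ hp fun n η hη => ?_
  have hfac : 0 < 1 - (2 : ℝ) ^ (-γ) :=
    sub_pos.2 (Real.rpow_lt_one_of_one_lt_of_neg one_lt_two (by linarith))
  -- The error is at most `n` end terms (`n + 1` avoids dividing by 0), and `1 - 2 ^ (-γ)` is the
  -- loss in comparing the sum with the integral.
  obtain ⟨a, N, haN⟩ := hint (η * (1 - 2 ^ (-γ)) / (n + 1)) (by positivity)
  set M : ℝ := (2 : ℝ) ^ a with hM
  set L : ℝ := (2 : ℝ) ^ (a + (N : ℤ)) with hL
  set A : ℝ := (2 : ℝ) ^ (-(γ * (a + N : ℤ))) with hA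
  set B : ℝ := (2 : ℝ) ^ (-(γ * a)) with hB
  have hM0 : 0 < M := by positivity
  have hL0 : 0 < L := by positivity
  have hA0 : 0 < A := by positivity
  have hB0 : 0 < B := by positivity
  have hAL : A = L ^ (-γ) := by
    rw [hA, hL, ← Real.rpow_intCast, ← Real.rpow_mul zero_le_two]; congr 1; ring
  have hBM : B = M ^ (-γ) := by
    rw [hB, hM, ← Real.rpow_intCast, ← Real.rpow_mul zero_le_two]; congr 1; ring
  have hiff : ∀ {s X : ℝ}, 0 < s → 0 < X → (s ^ (-γ⁻¹) ≤ X ↔ X ^ (-γ) ≤ s) := fun hs hX => by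
    rw [← inv_neg]; exact Real.rpow_inv_le_iff_of_neg hs hX (by linarith)
  set y : ℝ → ℝ≥0∞ := fun s => psiExt ψ hψ (ENNReal.ofReal (s ^ (-γ⁻¹))) with hy
  set I : ℝ≥0∞ := ∫⁻ s in Ico A B, y s with hI
  have hItop : I ≠ ∞ := by
    refine ((setLIntegral_mono' (g := fun _ => psiExt ψ hψ (ENNReal.ofReal L)) measurableSet_Ico
      fun s hs => ?_).trans_lt ?_).ne
    · have hs0 : 0 < s := hA0.trans_le hs.1
      exact psiExt_mono hψ (ENNReal.ofReal_le_ofReal ((hiff hs0 hL0).2 (by rw [← hAL]; exact hs.1)))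
    · rw [setLIntegral_const, Real.volume_Ico, psiExt_ofReal hψ hconc hzero hL0.le]
      exact ENNReal.mul_lt_top ENNReal.ofReal_lt_top ENNReal.ofReal_lt_top
  have hIr : ENNReal.ofReal I.toReal = I := ENNReal.ofReal_toReal hItop
  have hsum := sum_le_lintegral_psiExt hψ hconc hzero hpos hγ0 a N
  rw [← hI, ← hIr, ENNReal.ofReal_le_ofReal_iff ENNReal.toReal_nonneg] at hsum
  set S := ∑ i ∈ Finset.range N, (2 : ℝ) ^ (-(γ * (a + i : ℤ))) * ψ ((2 : ℝ) ^ (a + (i : ℤ)))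
  have hψL := hpos L hL0
  have hψM := hpos M hM0
  have hends : (n + 1) * (B * ψ M + A * ψ L) ≤ η * I.toReal := by
    rw [div_mul_eq_mul_div, le_div_iff₀ (by positivity)] at haN
    have := mul_le_mul_of_nonneg_left hsum hη.le
    linarith
  have hAψ : 0 < A * ψ L := by positivity
  have hBψ : 0 < B * ψ M := by positivity
  have hI0 : 0 < I.toReal := by
    by_contra! hcon
    have h1 : 0 < (n + 1) * (B * ψ M + A * ψ L) := by positivity
    nlinarith
  refine ⟨truncPower P M L, L, I.toReal, measurable_truncPower P M L, hL0.le,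
    fun t ht => indicator_of_notMem ht _, hI0, fun c hc => ?_⟩
  have hc1 := sum_abs_rpow_of_norm_eq_one hp hp' hc
  have hle : ∀ k, |c k| ≤ 1 := fun k => by
    have h1 : |c k| ^ P ≤ 1 := by
      rw [← hc1]
      exact Finset.single_le_sum (f := fun k => |c k| ^ P) (fun _ _ => by positivity)
        (Finset.mem_univ k)
    by_contra! hcon
    exact absurd h1 (not_le.2 (Real.one_lt_rpow hcon hP0))
  set H : ℝ → ℝ≥0∞ := fun s =>
    ∑ k, distribFun (fun t => c k * truncPower P M L t) (ENNReal.ofReal s ^ (1 / q)) with hH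
  have hroot : ∀ {s : ℝ}, 0 < s → ENNReal.ofReal s ^ (1 / q) = ENNReal.ofReal (s ^ (1 / q)) :=
    fun hs => ENNReal.ofReal_rpow_of_nonneg hs.le (by positivity)
  have hrootP : ∀ {s : ℝ}, 0 < s → (s ^ (1 / q)) ^ (-P) = s ^ (-γ⁻¹) := fun hs => by
    rw [← Real.rpow_mul hs.le, hγP]; congr 1; field_simp
  have hsumP : ∀ {s : ℝ}, 0 < s →
      ∑ k, ENNReal.ofReal ((|c k| / s ^ (1 / q)) ^ P) = ENNReal.ofReal (s ^ (-γ⁻¹)) := fun hs => by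
    rw [← ENNReal.ofReal_sum_of_nonneg fun k _ => by positivity]
    congr 1
    have : ∀ k, (|c k| / _ ^ (1 / q)) ^ P = |c k| ^ P * (_ ^ (1 / q)) ^ (-P) := fun k => by
      rw [Real.div_rpow (abs_nonneg _) (Real.rpow_nonneg hs.le _), Real.rpow_neg
        (Real.rpow_nonneg hs.le _), div_eq_mul_inv]
    simp only [this]
    rw [← Finset.sum_mul, hc1, one_mul, hrootP hs]
  -- `A` and `B` are the levels at which the cut at `L` and the cap at `M` take effect: below `A`
  -- the total measure is at most `n * L`, between them the ideal distribution bounds it, and from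
  -- `B` on nothing is left.
  have hupper : ∀ s ∈ Ioi (0 : ℝ), psiExt ψ hψ (H s) ≤
      (Iio A).indicator (fun _ => n * ENNReal.ofReal (ψ L)) s + (Ico A B).indicator y s := by
    intro s hs
    have hτ : 0 < s ^ (1 / q) := Real.rpow_pos_of_pos hs _
    rcases lt_or_ge s A with hsA | hsA
    · rw [indicator_of_mem (show s ∈ Iio A from hsA)]
      refine le_add_right ?_
      rw [← psiExt_ofReal hψ hconc hzero hL0.le]
      refine le_trans (psiExt_mono hψ ?_) (psiExt_natCast_mul_le hψ hconc hzero n _)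
      simp only [hH, hroot hs]
      exact (Finset.sum_le_sum fun k _ => distribFun_truncPower_le_length hτ).trans (by simp)
    rcases lt_or_ge s B with hsB | hsB
    · rw [indicator_of_mem (show s ∈ Ico A B from ⟨hsA, hsB⟩)]
      refine le_add_left (psiExt_mono hψ ?_)
      simp only [hH, hroot hs]
      exact (Finset.sum_le_sum fun k _ => distribFun_truncPower_le hP0 hτ).trans (hsumP hs).le
    · have hz : H s = 0 := by
        simp only [hH, hroot hs]
        refine Finset.sum_eq_zero fun k _ => distribFun_truncPower_eq_zero hP0 hτ hM0 (hle k) ?_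
        rw [hrootP hs, hiff hs hM0, ← hBM]
        exact hsB
      rw [hz, psiExt_zero]
      exact zero_le
  have hlower : ∀ s ∈ Ioi (0 : ℝ), (Ico A B).indicator y s ≤ psiExt ψ hψ (H s) +
      (Iio B).indicator (fun _ => n * ENNReal.ofReal (ψ M)) s := by
    intro s hs
    have hτ : 0 < s ^ (1 / q) := Real.rpow_pos_of_pos hs _
    by_cases hsAB : s ∈ Ico A B
    swap
    · rw [indicator_of_notMem hsAB]; exact zero_le
    rw [indicator_of_mem hsAB, indicator_of_mem (show s ∈ Iio B from hsAB.2),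
      ← psiExt_ofReal hψ hconc hzero hM0.le]
    refine le_trans ?_ (add_le_add_right (psiExt_natCast_mul_le hψ hconc hzero n _) _)
    refine le_trans (psiExt_mono hψ ?_) (psiExt_add_le hψ hconc hzero _ _)
    rw [← hsumP hs]
    refine (Finset.sum_le_sum fun k _ => le_distribFun_truncPower hP0 hτ hM0 (hle k)
      (L := L) ?_).trans ?_
    · rw [hrootP hs, hiff hs hL0, ← hAL]; exact hsAB.1
    · rw [Finset.sum_add_distrib]
      simp only [hH, hroot hs, Finset.sum_const, Finset.card_univ, Fintype.card_fin,
        nsmul_eq_mul, le_refl]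
  have hIind : ∫⁻ s in Ioi (0 : ℝ), (Ico A B).indicator y s = I := by
    rw [lintegral_indicator measurableSet_Ico, Measure.restrict_restrict measurableSet_Ico]
    congr 2
    exact inter_eq_left.2 fun s hs => hA0.trans_le hs.1
  have hnends : ∀ X t : ℝ, n * ENNReal.ofReal X * ENNReal.ofReal t =
      ENNReal.ofReal (n * X * t) ∨ X < 0 := fun X t => by
    rcases lt_or_ge X 0 with h | h
    · exact Or.inr h
    · left
      rw [ENNReal.ofReal_mul (by positivity), ENNReal.ofReal_mul (by positivity),
        ENNReal.ofReal_natCast]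
  have hΦup : ∫⁻ s in Ioi (0 : ℝ), psiExt ψ hψ (H s) ≤ ENNReal.ofReal (n * ψ L * A) + I := by
    refine (setLIntegral_mono' measurableSet_Ioi hupper).trans ?_
    rw [lintegral_add_left (measurable_const.indicator measurableSet_Iio),
      setLIntegral_indicator_Iio_const, hIind, (hnends _ _).resolve_right hψL.le.not_gt]
  have hΦlow : I ≤ (∫⁻ s in Ioi (0 : ℝ), psiExt ψ hψ (H s)) + ENNReal.ofReal (n * ψ M * B) := by
    rw [← hIind]
    refine (setLIntegral_mono' measurableSet_Ioi hlower).trans ?_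
    rw [lintegral_add_right _ (measurable_const.indicator measurableSet_Iio),
      setLIntegral_indicator_Iio_const, (hnends _ _).resolve_right hψM.le.not_gt]
  have hn0 : (0 : ℝ) ≤ n := n.cast_nonneg
  have hnA : 0 ≤ n * (A * ψ L) := by positivity
  have hnB : 0 ≤ n * (B * ψ M) := by positivity
  constructor
  · rw [show (1 - η) * I.toReal = I.toReal - η * I.toReal by ring,
      ENNReal.ofReal_sub _ (by positivity), hIr, tsub_le_iff_right]
    refine hΦlow.trans (add_le_add_right (ENNReal.ofReal_le_ofReal ?_) _)
    linarith
  · refine hΦup.trans ?_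
    nth_rw 1 [← hIr]
    rw [← ENNReal.ofReal_add (by positivity) ENNReal.toReal_nonneg]
    refine ENNReal.ofReal_le_ofReal ?_
    linarith

/-! ### The dilation indices -/

theorem IsGrowthExponent.nonneg {ι : Type*} [Nonempty ι] {q : ℝ} (hq : 0 < q) {x y : ι → ℕ → ℝ}
    {L : ℝ} (h : IsGrowthExponent q x y L) (hy : ∀ i n, 0 < y i n) (hyx : ∀ i n, y i n ≤ x i n) :
    0 ≤ L := by
  by_contra! hL
  obtain ⟨i⟩ := ‹Nonempty ι›
  obtain ⟨n, hn, hn0⟩ := ((h.1 (L / 2) (by linarith)).and (eventually_gt_atTop 0)).exists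
  have hn' : (0 : ℝ) < n := by exact_mod_cast hn0
  have h1 : (2 : ℝ) ^ (q * (L / 2) * n) < 1 := Real.rpow_lt_one_of_one_lt_of_neg one_lt_two
    (mul_neg_of_neg_of_pos (mul_neg_of_pos_of_neg hq (by linarith)) hn')
  have h2 := mul_lt_mul_of_pos_right h1 (hy i n)
  linarith [hn i, hyx i n]

theorem IsGrowthExponent.nonpos {ι : Type*} {q : ℝ} {x y : ι → ℕ → ℝ}
    {L : ℝ} (h : IsGrowthExponent q x y L) (hxy : ∀ i n, x i n ≤ y i n) : L ≤ 0 :=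
  h.2 0 1 one_pos (Eventually.of_forall fun n i => by simpa using hxy i n)

theorem weight_add_natCast_le {ψ : ℝ → ℝ} (hconc : ConcaveOn ℝ (Ici 0) ψ) (hzero : ψ 0 = 0)
    (k : ℤ) (n : ℕ) : ψ ((2 : ℝ) ^ (k + n)) ≤ 2 ^ n * ψ ((2 : ℝ) ^ k) :=
  le_two_pow_mul_of_le (v := fun k => ψ ((2 : ℝ) ^ k)) (weight_zpow_succ_le hconc hzero) k n

theorem weight_le_two_pow_mul {ψ : ℝ → ℝ} (hψ : MonotoneOn ψ (Ici 0))
    (hpos : ∀ t : ℝ, 0 < t → 0 < ψ t) {k l : ℤ} (h : k ≤ l) (n : ℕ) :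
    ψ ((2 : ℝ) ^ k) ≤ 2 ^ n * ψ ((2 : ℝ) ^ l) :=
  (weight_le_zpow_add hψ h).trans
    (le_mul_of_one_le_left (hpos _ (by positivity)).le (one_le_pow₀ one_le_two))

theorem alphaIdx_spec {q : ℝ} (hq : 1 ≤ q) {ψ : ℝ → ℝ} (hψ : MonotoneOn ψ (Ici 0))
    (hconc : ConcaveOn ℝ (Ici 0) ψ) (hzero : ψ 0 = 0) (hpos : ∀ t : ℝ, 0 < t → 0 < ψ t) :
    Tendsto (alphaSeq q ψ) atTop (𝓝 (alphaIdx q ψ)) ∧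
      IsGrowthExponent q (fun (k : ℤ) (_ : ℕ) => ψ ((2 : ℝ) ^ k))
        (fun k n => ψ ((2 : ℝ) ^ (k + n))) (-alphaIdx q ψ) := by
  have hp := fun k : ℤ => hpos ((2 : ℝ) ^ k) (by positivity)
  obtain ⟨L, hL, hg⟩ := exists_growthExponent (ι := ℤ) hq
    (x := fun (k : ℤ) (_ : ℕ) => ψ ((2 : ℝ) ^ k)) (y := fun k n => ψ ((2 : ℝ) ^ (k + n)))
    (fun _ _ => hp _) (fun _ _ => hp _)
    (fun k n => weight_le_two_pow_mul hψ hpos (by omega) n)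
    (fun k n => weight_add_natCast_le hconc hzero k n) (fun k m n => ⟨k + m, by
      rw [div_mul_div_cancel₀ (hp _).ne', Nat.cast_add, add_assoc]⟩)
  have hlim : Tendsto (alphaSeq q ψ) atTop (𝓝 (-L)) := hL.neg.congr fun n => by
    simp only [alphaSeq, add_comm]
  rw [alphaIdx, hlim.limUnder_eq, neg_neg]
  exact ⟨hlim, hg⟩

theorem betaIdx_spec {q : ℝ} (hq : 1 ≤ q) {ψ : ℝ → ℝ} (hψ : MonotoneOn ψ (Ici 0))
    (hconc : ConcaveOn ℝ (Ici 0) ψ) (hzero : ψ 0 = 0) (hpos : ∀ t : ℝ, 0 < t → 0 < ψ t) :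
    Tendsto (betaSeq q ψ) atTop (𝓝 (betaIdx q ψ)) ∧
      IsGrowthExponent q (fun (k : ℤ) (n : ℕ) => ψ ((2 : ℝ) ^ (k + n)))
        (fun k _ => ψ ((2 : ℝ) ^ k)) (betaIdx q ψ) := by
  have hp := fun k : ℤ => hpos ((2 : ℝ) ^ k) (by positivity)
  obtain ⟨L, hL, hg⟩ := exists_growthExponent (ι := ℤ) hq
    (x := fun (k : ℤ) (n : ℕ) => ψ ((2 : ℝ) ^ (k + n))) (y := fun k _ => ψ ((2 : ℝ) ^ k))
    (fun _ _ => hp _) (fun _ _ => hp _)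
    (fun k n => weight_add_natCast_le hconc hzero k n)
    (fun k n => weight_le_two_pow_mul hψ hpos (by omega) n) (fun k m n => ⟨k + m, by
      rw [mul_comm, div_mul_div_cancel₀ (hp _).ne', Nat.cast_add, add_assoc]⟩)
  have hlim : Tendsto (betaSeq q ψ) atTop (𝓝 L) := hL.congr fun n => by
    simp only [betaSeq, add_comm]
  rw [betaIdx, hlim.limUnder_eq]
  exact ⟨hlim, hg⟩

/-- The restriction `0 ≤ k` is stable under `k ↦ k + m`, so submultiplicativity still telescopes.
For `betaZeroIdx_spec`, `k ≤ 0` is stable under `k ↦ k - m`. -/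
theorem alphaInfIdx_spec {q : ℝ} (hq : 1 ≤ q) {ψ : ℝ → ℝ} (hψ : MonotoneOn ψ (Ici 0))
    (hconc : ConcaveOn ℝ (Ici 0) ψ) (hzero : ψ 0 = 0) (hpos : ∀ t : ℝ, 0 < t → 0 < ψ t) :
    Tendsto (alphaInfSeq q ψ) atTop (𝓝 (alphaInfIdx q ψ)) ∧
      IsGrowthExponent q (fun (k : {k : ℤ // 0 ≤ k}) (_ : ℕ) => ψ ((2 : ℝ) ^ (k : ℤ)))
        (fun k n => ψ ((2 : ℝ) ^ ((k : ℤ) + n))) (-alphaInfIdx q ψ) := by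
  have hp := fun k : ℤ => hpos ((2 : ℝ) ^ k) (by positivity)
  have : Nonempty {k : ℤ // 0 ≤ k} := ⟨⟨0, le_rfl⟩⟩
  obtain ⟨L, hL, hg⟩ := exists_growthExponent (ι := {k : ℤ // 0 ≤ k}) hq
    (x := fun k (_ : ℕ) => ψ ((2 : ℝ) ^ (k : ℤ))) (y := fun k n => ψ ((2 : ℝ) ^ ((k : ℤ) + n)))
    (fun _ _ => hp _) (fun _ _ => hp _)
    (fun k n => weight_le_two_pow_mul hψ hpos (by omega) n)
    (fun k n => weight_add_natCast_le hconc hzero k n)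
    (fun k m n => ⟨⟨k + m, add_nonneg k.2 (Int.natCast_nonneg m)⟩, by
      rw [div_mul_div_cancel₀ (hp _).ne', Nat.cast_add, add_assoc]⟩)
  have hlim : Tendsto (alphaInfSeq q ψ) atTop (𝓝 (-L)) := hL.neg
  rw [alphaInfIdx, hlim.limUnder_eq, neg_neg]
  exact ⟨hlim, hg⟩

theorem betaZeroIdx_spec {q : ℝ} (hq : 1 ≤ q) {ψ : ℝ → ℝ} (hψ : MonotoneOn ψ (Ici 0))
    (hconc : ConcaveOn ℝ (Ici 0) ψ) (hzero : ψ 0 = 0) (hpos : ∀ t : ℝ, 0 < t → 0 < ψ t) :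
    Tendsto (betaZeroSeq q ψ) atTop (𝓝 (betaZeroIdx q ψ)) ∧
      IsGrowthExponent q (fun (k : {k : ℤ // k ≤ 0}) (_ : ℕ) => ψ ((2 : ℝ) ^ (k : ℤ)))
        (fun k n => ψ ((2 : ℝ) ^ ((k : ℤ) - n))) (betaZeroIdx q ψ) := by
  have hp := fun k : ℤ => hpos ((2 : ℝ) ^ k) (by positivity)
  have : Nonempty {k : ℤ // k ≤ 0} := ⟨⟨0, le_rfl⟩⟩
  obtain ⟨L, hL, hg⟩ := exists_growthExponent (ι := {k : ℤ // k ≤ 0}) hq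
    (x := fun k (_ : ℕ) => ψ ((2 : ℝ) ^ (k : ℤ))) (y := fun k n => ψ ((2 : ℝ) ^ ((k : ℤ) - n)))
    (fun _ _ => hp _) (fun _ _ => hp _)
    (fun k n => by simpa using weight_add_natCast_le hconc hzero ((k : ℤ) - n) n)
    (fun k n => weight_le_two_pow_mul hψ hpos (by omega) n)
    (fun k m n => ⟨⟨k - m, by have := k.2; omega⟩, by
      rw [div_mul_div_cancel₀ (hp _).ne', Nat.cast_add, sub_sub]⟩)
  have hlim : Tendsto (betaZeroSeq q ψ) atTop (𝓝 L) := hL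
  rw [betaZeroIdx, hlim.limUnder_eq]
  exact ⟨hlim, hg⟩

/-- Otherwise `ψ` gains a factor `1 + η` over every `m + 1` dyadic steps, hence doubles over every
`N` steps, which gives `α ≥ 1 / (N q) > 0`. -/
theorem exists_flat_of_alphaIdx_eq_zero {q : ℝ} (hq : 1 ≤ q) {ψ : ℝ → ℝ}
    (hψ : MonotoneOn ψ (Ici 0)) (hconc : ConcaveOn ℝ (Ici 0) ψ) (hzero : ψ 0 = 0)
    (hpos : ∀ t : ℝ, 0 < t → 0 < ψ t) (hα : alphaIdx q ψ = 0) (n : ℕ) {η : ℝ} (hη : 0 < η) :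
    ∃ L : ℝ, 0 < L ∧ ψ (n * L) ≤ (1 + η) * ψ L := by
  by_contra! hcon
  have hq0 : 0 < q := by linarith
  obtain ⟨m, hm⟩ : ∃ m : ℕ, n ≤ 2 ^ (m + 1) :=
    ⟨n, (Nat.lt_two_pow_self.le).trans (Nat.pow_le_pow_right two_pos (Nat.le_succ n))⟩
  obtain ⟨J, hJ⟩ := pow_unbounded_of_one_lt 2 (show 1 < 1 + η by linarith)
  have hJ0 : 0 < J := by
    by_contra! h0
    obtain rfl : J = 0 := by omega
    norm_num at hJ
  have hp := fun k : ℤ => hpos ((2 : ℝ) ^ k) (by positivity)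
  have hstep : ∀ k : ℤ, (1 + η) * ψ ((2 : ℝ) ^ k) ≤ ψ ((2 : ℝ) ^ (k + (m + 1 : ℕ))) := fun k => by
    refine (hcon _ (by positivity)).le.trans
      (hψ (mem_Ici.2 (by positivity)) (mem_Ici.2 (by positivity)) ?_)
    rw [zpow_add₀ two_ne_zero, mul_comm]
    refine mul_le_mul_of_nonneg_left ?_ (by positivity)
    rw [zpow_natCast]
    exact_mod_cast hm
  have hiter : ∀ (j : ℕ) (k : ℤ),
      (1 + η) ^ j * ψ ((2 : ℝ) ^ k) ≤ ψ ((2 : ℝ) ^ (k + ((m + 1) * j : ℕ))) := fun j k => by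
    induction j with
    | zero => simp
    | succ j ih =>
      have h1 := hstep (k + ((m + 1) * j : ℕ))
      rw [show k + (((m + 1) * (j + 1) : ℕ) : ℤ) = k + ((m + 1) * j : ℕ) + (m + 1 : ℕ) by
        push_cast; ring, pow_succ]
      have h2 := mul_le_mul_of_nonneg_left ih (show 0 ≤ 1 + η by linarith)
      linarith
  set N : ℕ := (m + 1) * J with hN
  have hN0 : 0 < N := by positivity
  have hdouble : ∀ k : ℤ, 2 * ψ ((2 : ℝ) ^ k) ≤ ψ ((2 : ℝ) ^ (k + (N : ℤ))) := fun k =>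
    (mul_le_mul_of_nonneg_right hJ.le (hp k).le).trans (hiter J k)
  have hgrow := (alphaIdx_spec hq hψ hconc hzero hpos).2.2 (-(1 / (N * q))) (2 ^ (N + 1 + 2 * 0))
    (by positivity) (Eventually.of_forall fun n k => by
      have := exp_growth_of_step (v := fun k => ψ ((2 : ℝ) ^ k)) hp
        (weight_zpow_succ_le hconc hzero)
        (fun k => by
          have := weight_le_zpow_add hψ (show k ≤ k + 1 by omega)
          linarith [hp (k + 1)]) hN0 (K := k) (k := k) (fun l _ => hdouble l) 0 (by simp) n
      convert this using 3
      field_simp)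
  have : (0 : ℝ) < 1 / (N * q) := by positivity
  linarith

/-! ### The main theorem -/

theorem symmFinitelyRepresented_lorentz_iff {q : ℝ} (hq : 1 ≤ q) {ψ : ℝ → ℝ}
    (hψ : MonotoneOn ψ (Ici 0)) (hconc : ConcaveOn ℝ (Ici 0) ψ) (hzero : ψ 0 = 0)
    (hpos : ∀ t : ℝ, 0 < t → 0 < ψ t) {p : ℝ≥0∞} (hp : 1 ≤ p) :
    SymmFinitelyRepresented (lorentzNorm q ψ hψ) p ↔
      alphaIdx q ψ ≤ (p⁻¹).toReal ∧ (p⁻¹).toReal ≤ betaIdx q ψ ∧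
        ((p⁻¹).toReal ≤ betaZeroIdx q ψ ∨ alphaInfIdx q ψ ≤ (p⁻¹).toReal) := by
  have hq0 : 0 < q := by linarith
  have hp2 := fun k : ℤ => hpos ((2 : ℝ) ^ k) (by positivity)
  have hα := (alphaIdx_spec hq hψ hconc hzero hpos).2
  have hβ := (betaIdx_spec hq hψ hconc hzero hpos).2
  have hαi := (alphaInfIdx_spec hq hψ hconc hzero hpos).2
  have hβz := (betaZeroIdx_spec hq hψ hconc hzero hpos).2
  have : Nonempty {k : ℤ // k ≤ 0} := ⟨⟨0, le_rfl⟩⟩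
  have hα0 := hα.nonpos fun k n => weight_le_zpow_add hψ (by omega)
  have hβ0 := hβ.nonneg hq0 (fun _ _ => hp2 _) fun k n => weight_le_zpow_add hψ (by omega)
  have hβz0 := hβz.nonneg hq0 (fun _ _ => hp2 _) fun k n => weight_le_zpow_add hψ (by omega)
  set g := (p⁻¹).toReal with hg
  refine ⟨fun hrep => ⟨le_recip_of_represented hq hψ hconc hzero hp hrep hα,
    recip_le_of_represented hq hψ hconc hzero hp hrep hβ0 hβ, ?_⟩, fun ⟨h1, h2, h3⟩ => ?_⟩
  · rcases le_or_gt g (betaZeroIdx q ψ) with h | h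
    · exact Or.inl h
    · exact Or.inr (not_represented_of_valley hq hψ hconc hzero hpos hp hrep hβz0 hαi hβz h)
  rcases eq_or_ne p ∞ with rfl | hp'
  · have hg0 : g = 0 := by simp [hg]
    exact represented_top hq hψ hconc hzero hpos fun n η hη =>
      exists_flat_of_alphaIdx_eq_zero hq hψ hconc hzero hpos (by linarith) n hη
  -- Concavity gives `ψ(2t) ≤ 2ψ(t)`, which is what places `γ = q * g` in `[0, 1]`.
  have hβ1 : betaIdx q ψ ≤ 1 / q := hβ.2 _ 1 one_pos (Eventually.of_forall fun n k => by
    rw [mul_one_div_cancel hq0.ne', one_mul, one_mul, Real.rpow_natCast]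
    exact weight_add_natCast_le hconc hzero k n)
  have hγ0 : 0 ≤ q * g := mul_nonneg hq0.le ENNReal.toReal_nonneg
  have hγ1 : q * g ≤ 1 := by
    have := mul_le_mul_of_nonneg_left (h2.trans hβ1) hq0.le
    rwa [mul_one_div_cancel hq0.ne'] at this
  rcases exists_interval_or_growth (V := fun k => ψ ((2 : ℝ) ^ k)) hp2
    (fun k => weight_le_zpow_add hψ (by omega)) (weight_zpow_succ_le hconc hzero) hγ0 hγ1 with
    hint | ⟨δ, hδ, C, hC, hcases⟩
  · exact represented_of_intervals hq hψ hconc hzero hpos hp hp' rfl hint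
  exfalso
  have hδq : 0 < δ / q := by positivity
  have e1 : ∀ n : ℕ, -((q * g + δ) * n) = q * (-(g + δ / q)) * n := fun n => by field_simp
  have e2 : ∀ n : ℕ, (q * g - δ) * n = q * (g - δ / q) * n := fun n => by field_simp
  simp only [e1, e2] at hcases
  rcases hcases with h | h | ⟨h, h'⟩
  · have := hα.2 _ C hC (Eventually.of_forall fun n k => h k n)
    linarith
  · have := hβ.2 _ C hC (Eventually.of_forall fun n k => by simpa using h (k + n) n)
    linarith
  · have i1 := hαi.2 _ C hC (Eventually.of_forall fun n k => h k k.2 n)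
    have i2 := hβz.2 _ C hC (Eventually.of_forall fun n k => h' k k.2 n)
    rcases h3 with h3 | h3 <;> linarith

theorem recipIdx_le_iff {p : ℝ≥0∞} (hp : 1 ≤ p) {a : ℝ} (ha : 0 ≤ a) :
    recipIdx a ≤ p ↔ (p⁻¹).toReal ≤ a := by
  have hp' : p⁻¹ ≠ ∞ := by simp; positivity
  rw [recipIdx, ENNReal.inv_le_iff_inv_le, ENNReal.le_ofReal_iff_toReal_le hp' ha]

theorem le_recipIdx_iff {p : ℝ≥0∞} (hp : 1 ≤ p) {a : ℝ} :
    p ≤ recipIdx a ↔ a ≤ (p⁻¹).toReal := by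
  have hp' : p⁻¹ ≠ ∞ := by simp; positivity
  rw [recipIdx, ENNReal.le_inv_iff_le_inv, ENNReal.ofReal_le_iff_le_toReal hp']

theorem mainTheorem5 (q : ℝ) (hq : 1 ≤ q) (ψ : ℝ → ℝ)
    (hmono : MonotoneOn ψ (Ici 0)) (hconc : ConcaveOn ℝ (Ici 0) ψ) (hzero : ψ 0 = 0)
    (hpos : ∀ t : ℝ, 0 < t → 0 < ψ t) :
    -- the limits defining the indices exist and are nonnegative
    (Tendsto (alphaSeq q ψ) atTop (𝓝 (alphaIdx q ψ)) ∧
      Tendsto (betaSeq q ψ) atTop (𝓝 (betaIdx q ψ)) ∧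
      Tendsto (alphaInfSeq q ψ) atTop (𝓝 (alphaInfIdx q ψ)) ∧
      Tendsto (betaZeroSeq q ψ) atTop (𝓝 (betaZeroIdx q ψ)) ∧
      0 ≤ alphaIdx q ψ ∧ 0 ≤ betaIdx q ψ ∧ 0 ≤ alphaInfIdx q ψ ∧ 0 ≤ betaZeroIdx q ψ) ∧
    (alphaInfIdx q ψ ≤ betaZeroIdx q ψ →
      symmRepSet (lorentzNorm q ψ hmono) =
        Icc (recipIdx (betaIdx q ψ)) (recipIdx (alphaIdx q ψ))) ∧
    (betaZeroIdx q ψ < alphaInfIdx q ψ →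
      symmRepSet (lorentzNorm q ψ hmono) =
        Icc (recipIdx (betaIdx q ψ)) (recipIdx (alphaInfIdx q ψ)) ∪
          Icc (recipIdx (betaZeroIdx q ψ)) (recipIdx (alphaIdx q ψ))) := by
  have hq0 : 0 < q := by linarith
  have hp2 := fun k : ℤ => hpos ((2 : ℝ) ^ k) (by positivity)
  obtain ⟨tα, hα⟩ := alphaIdx_spec hq hmono hconc hzero hpos
  obtain ⟨tβ, hβ⟩ := betaIdx_spec hq hmono hconc hzero hpos
  obtain ⟨tαi, hαi⟩ := alphaInfIdx_spec hq hmono hconc hzero hpos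
  obtain ⟨tβz, hβz⟩ := betaZeroIdx_spec hq hmono hconc hzero hpos
  have : Nonempty {k : ℤ // k ≤ 0} := ⟨⟨0, le_rfl⟩⟩
  have hα0 : 0 ≤ alphaIdx q ψ := neg_nonpos.1 (hα.nonpos fun k n =>
    weight_le_zpow_add hmono (by omega))
  have hαi0 : 0 ≤ alphaInfIdx q ψ := neg_nonpos.1 (hαi.nonpos fun k n =>
    weight_le_zpow_add hmono (by omega))
  have hβ0 := hβ.nonneg hq0 (fun _ _ => hp2 _) fun k n => weight_le_zpow_add hmono (by omega)
  have hβz0 := hβz.nonneg hq0 (fun _ _ => hp2 _) fun k n => weight_le_zpow_add hmono (by omega)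
  have hβ1 : betaIdx q ψ ≤ 1 := (hβ.2 (1 / q) 1 one_pos (Eventually.of_forall fun n k => by
    rw [mul_one_div_cancel hq0.ne', one_mul, one_mul, Real.rpow_natCast]
    exact weight_add_natCast_le hconc hzero k n)).trans ((div_le_one hq0).2 hq)
  -- This and `hβzβ` ensure that both intervals of the union in case (ii) satisfy the outer bounds
  -- `α ≤ 1/p ≤ β`.
  have hααi : alphaIdx q ψ ≤ alphaInfIdx q ψ := by
    rw [← neg_le_neg_iff]
    refine le_of_forall_gt_imp_ge_of_dense fun δ hδ => hαi.2 δ 1 one_pos ?_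
    filter_upwards [hα.1 δ hδ] with n hn k
    rw [one_mul]
    exact hn k
  have hβzβ : betaZeroIdx q ψ ≤ betaIdx q ψ := by
    refine le_of_forall_gt_imp_ge_of_dense fun δ hδ => hβz.2 δ 1 one_pos ?_
    filter_upwards [hβ.1 δ hδ] with n hn k
    rw [one_mul]
    simpa using hn ((k : ℤ) - n)
  -- Since `β⁰ ≤ β ≤ 1`, every exponent in the stated intervals is automatically at least 1.
  have hone : ∀ {b : ℝ} {p : ℝ≥0∞}, b ≤ 1 → recipIdx b ≤ p → 1 ≤ p := fun hb h => by
    refine le_trans ?_ h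
    rw [recipIdx, ENNReal.one_le_inv]
    exact ENNReal.ofReal_le_one.2 hb
  refine ⟨⟨tα, tβ, tαi, tβz, hα0, hβ0, hαi0, hβz0⟩, fun hcase => ?_, fun hcase => ?_⟩
  · ext p
    refine ⟨fun ⟨hp, hrep⟩ => ?_, fun h => ?_⟩
    · rw [symmFinitelyRepresented_lorentz_iff hq hmono hconc hzero hpos hp] at hrep
      exact ⟨(recipIdx_le_iff hp hβ0).2 hrep.2.1, (le_recipIdx_iff hp).2 hrep.1⟩
    · have hp := hone hβ1 h.1
      refine ⟨hp, (symmFinitelyRepresented_lorentz_iff hq hmono hconc hzero hpos hp).2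
        ⟨(le_recipIdx_iff hp).1 h.2, (recipIdx_le_iff hp hβ0).1 h.1, ?_⟩⟩
      -- When `α^∞ ≤ β⁰`, the third condition of the criterion always holds.
      rcases le_total (p⁻¹).toReal (betaZeroIdx q ψ) with h' | h'
      · exact Or.inl h'
      · exact Or.inr (hcase.trans h')
  · ext p
    refine ⟨fun ⟨hp, hrep⟩ => ?_, fun h => ?_⟩
    · rw [symmFinitelyRepresented_lorentz_iff hq hmono hconc hzero hpos hp] at hrep
      obtain ⟨h1, h2, h3 | h3⟩ := hrep
      · exact Or.inr ⟨(recipIdx_le_iff hp hβz0).2 h3, (le_recipIdx_iff hp).2 h1⟩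
      · exact Or.inl ⟨(recipIdx_le_iff hp hβ0).2 h2, (le_recipIdx_iff hp).2 h3⟩
    · have hp : 1 ≤ p := h.elim (fun h => hone hβ1 h.1) (fun h => hone (hβzβ.trans hβ1) h.1)
      refine ⟨hp, (symmFinitelyRepresented_lorentz_iff hq hmono hconc hzero hpos hp).2 ?_⟩
      rcases h with ⟨h1, h2⟩ | ⟨h1, h2⟩
      · rw [recipIdx_le_iff hp hβ0] at h1
        rw [le_recipIdx_iff hp] at h2
        exact ⟨hααi.trans h2, h1, Or.inr h2⟩
      · rw [recipIdx_le_iff hp hβz0] at h1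
        rw [le_recipIdx_iff hp] at h2
        exact ⟨h2, h1.trans hβzβ, Or.inl h1⟩
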